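/- For $k\ge 0$ let $\mathcal P_k$ be the set of partitions of the $2k$-element set $\{1,\dots,k,1',\dots,k'\}$ (so $\mathcal P_0=\{\emptyset\}$), let $\mathrm{id}_k=\{\{i,i'\}: 1\le i\le k\}$ (with $\mathrm{id}_0=\emptyset$), let $\mathrm{nc}(p)$ be the number of blocks of $p$, and let $p\vee q$ be the finest partition coarser than $p$ and $q$. A partition $p\in\mathcal P_k$ is irreducible if $\mathrm{nc}(p\vee \mathrm{id}_k)=1$. Let $d(p,q)$ be half the length of a shortest path from $p$ to $q$ in the graph on $\mathcal P_k$ in which two partitions are adjacent if and only if one is obtained from the other by gluing two blocks. For $p\in\mathcal P_k$, $q\in\mathcal P_l$ let $p\otimes q\in\mathcal P_{k+l}$ be obtained by putting the diagram of $p$ to the left of that of $q$. For $p,q\in\mathcal P_k$, put the diagram of $q$ above that of $p$ and identify the lower row of $q$ with the upper row of $p$; let $p\circ q\in\mathcal P_k$ be the partition induced on the outer two rows by the connected components, and let $\kappa(p,q)$ be the number of connected components contained in the middle row. For $p,p'\in\mathcal P_k$ let the Kreweras complement $\mathsf K_p(p')$ be the set of $p''\in\mathcal P_k$ such that $p=p'\circ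 p''$ and $$d(\mathrm{id}_k,p)=d(\mathrm{id}_k,p')+d(\mathrm{id}_k,p'')-\frac{k+\mathrm{nc}(p)-\mathrm{nc}(p')-\mathrm{nc}(p'')}{2}-\kappa(p',p'').$$ The symmetric group $\mathfrak S_k$ acts on $\mathcal P_k$ by $p\mapsto\sigma\circ p\circ\sigma^{-1}$, where $\sigma$ is seen as the partition $\{\{i,\sigma(i)'\}: 1\le i\le k\}$; $[p]$ denotes the orbit of $p$. Let $A=\bigoplus_{k\ge0}\mathbb C[\mathcal P_k/\mathfrak S_k]$, with the product $[p]\cdot[q]=[p\otimes q]$ and the unit $[\emptyset]$. (1) Every orbit has the form $[p_1\otimes\dots\otimes p_r]$ with $r\ge 0$ and irreducible $p_i$, and there is a well-defined linear map $\Delta_\boxplus:A\to A\otimes A$ such that, for all irreducible $p_1,\dots,p_r$, $$\Delta_\boxplus([p_1\otimes\dots\otimes p_r])=\sum_{I\subset\{1,\dots,r\}}\Big[\bigotimes_{i\in I}p_i\Big]\otimes\Big[\bigotimes_{i\notin I}p_i\Big].$$ Let $\epsilon_\boxplus$ be the linear form with $\epsilon_\boxplus([\emptyset])=1$ that vanishes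 on every other orbit. Then $(A,\otimes,[\emptyset],\Delta_\boxplus,\epsilon_\boxplus)$, with $\mathbb C[\mathcal P_k/\mathfrak S_k]$ in degree $k$, is a graded connected Hopf algebra: it is an associative, coassociative, unital and counital bialgebra, its product, unit, coproduct and counit respect the grading, its degree $0$ part is $\mathbb C[\emptyset]$, and it has an antipode, which preserves the degree. (2) Let $\Delta_\boxtimes:A\to A\otimes A$ be the (well-defined) linear map with $$\Delta_\boxtimes([p])=\sum_{p_1,p_2\in\mathcal P_k:\ p_1\circ p_2=p,\ p_2\in\mathsf K_{p}(p_1)}[p_1]\otimes[p_2]\qquad(p\in\mathcal P_k),$$ and let $\epsilon_\boxtimes$ be the linear form with $\epsilon_\boxtimes([\mathrm{id}_k])=1$ for all $k\ge0$ that vanishes on every other orbit. Then $(A,\otimes,[\emptyset],\Delta_\boxtimes,\epsilon_\boxtimes)$ is an associative, coassociative, unital and counital bialgebra. -/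

import Mathlib

open scoped TensorProduct

/-! ### Partitions of a set, the Cayley graph and the geodesic distance

A partition of `α` is an equivalence relation `Setoid α`. In Mathlib's lattice of setoids
`p ≤ q` means that `p` is finer than `q`, and `p ⊔ q` is the finest partition that is coarser
than both. -/

namespace SetPartition

/-- The number of blocks. -/
noncomputable def nc {α : Type*} (p : Setoid α) : ℕ := Nat.card (Quotient p)

/-- `q` is obtained from `p` by gluing two (distinct) blocks of `p`, those of `x` and of `y`. -/
def Glue {α : Type*} (p q : Setoid α) : Prop :=
  ∃ x y, ¬ p x y ∧ ∀ u v, q u v ↔ p u v ∨ (p u x ∧ p y v) ∨ (p u y ∧ p x v)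

/-- The Cayley graph: `p` and `q` are joined by an edge if and only if one of them is obtained
from the other by gluing two blocks. -/
def cayleyGraph (α : Type*) : SimpleGraph (Setoid α) := SimpleGraph.fromRel Glue

/-- The geodesic distance: half of the minimal length of a path in the Cayley graph. -/
noncomputable def d {α : Type*} (p q : Setoid α) : ℝ := ((cayleyGraph α).dist p q : ℝ) / 2

instance {α : Type*} [Finite α] : Finite (Setoid α) :=
  Finite.of_injective (fun (p : Setoid α) x y => p x y) fun _ _ h =>
    Setoid.ext fun x y => iff_of_eq (congrFun (congrFun h x) y)

/-! Invariance under bijections of the underlying set. -/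

theorem nc_comap {α β : Type*} (e : α ≃ β) (p : Setoid β) : nc (p.comap e) = nc p := by
  refine Nat.card_congr (Quotient.congr (ra := p.comap e) (rb := p) e ?_)
  intro a b
  exact Iff.rfl

theorem glue_comap {α β : Type*} (e : α ≃ β) {p q : Setoid β} (h : Glue p q) :
    Glue (p.comap e) (q.comap e) := by
  obtain ⟨x, y, hxy, h⟩ := h
  refine ⟨e.symm x, e.symm y, ?_, fun u v => ?_⟩
  · simpa [Setoid.comap_rel] using hxy
  · simpa [Setoid.comap_rel] using h (e u) (e v)

theorem comap_equiv_injective {α β : Type*} (e : α ≃ β) :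
    Function.Injective (fun p : Setoid β => p.comap e) :=
  Setoid.comap_injective e e.surjective

/-- Relabelling is a homomorphism of Cayley graphs. -/
def cayleyHom {α β : Type*} (e : α ≃ β) : cayleyGraph β →g cayleyGraph α where
  toFun p := p.comap e
  map_rel' := by
    intro p q h
    rw [cayleyGraph, SimpleGraph.fromRel_adj] at h ⊢
    exact ⟨fun hh => h.1 (comap_equiv_injective e hh), h.2.imp (glue_comap e) (glue_comap e)⟩

theorem comap_symm_comap {α β : Type*} (e : α ≃ β) (p : Setoid β) :
    (p.comap e).comap e.symm = p := by
  ext x y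
  simp [Setoid.comap_rel]

theorem d_comap {α β : Type*} (e : α ≃ β) (p q : Setoid β) :
    d (p.comap e) (q.comap e) = d p q := by
  have key : ∀ {γ δ : Type _} (f : γ ≃ δ) (p q : Setoid δ), (cayleyGraph δ).Reachable p q →
      (cayleyGraph γ).dist (p.comap f) (q.comap f) ≤ (cayleyGraph δ).dist p q := by
    intro γ δ f p q h
    obtain ⟨w, hw⟩ := h.exists_walk_length_eq_dist
    rw [← hw, ← SimpleGraph.Walk.length_map (cayleyHom f) w]
    exact SimpleGraph.dist_le _
  have key' : ∀ {γ δ : Type _} (f : γ ≃ δ) (p q : Setoid δ), (cayleyGraph δ).Reachable p q →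
      (cayleyGraph γ).dist (p.comap f) (q.comap f) ≤ (cayleyGraph δ).dist p q := by
    intro γ δ f p q h
    obtain ⟨w, hw⟩ := h.exists_walk_length_eq_dist
    rw [← hw, ← SimpleGraph.Walk.length_map (cayleyHom f) w]
    exact SimpleGraph.dist_le _
  unfold d
  congr 2
  by_cases h : (cayleyGraph β).Reachable p q
  · refine le_antisymm (key e p q h) ?_
    have h' := key' e.symm (p.comap e) (q.comap e) (h.map (cayleyHom e))
    rwa [comap_symm_comap, comap_symm_comap] at h'
  · have h' : ¬ (cayleyGraph α).Reachable (p.comap e) (q.comap e) := by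
      intro hh
      have := hh.map (cayleyHom e.symm)
      change (cayleyGraph β).Reachable ((p.comap e).comap e.symm) ((q.comap e).comap e.symm) at this
      rw [comap_symm_comap, comap_symm_comap] at this
      exact h this
    rw [SimpleGraph.dist_eq_zero_of_not_reachable h, SimpleGraph.dist_eq_zero_of_not_reachable h']

/-! ### The set `𝒫_k` -/

/-- `𝒫_k`: the partitions of `{1, …, k} ∪ {1', …, k'}`. `Sum.inl i` is the point `i` of the top
row and `Sum.inr i` is the point `i'` of the bottom row. -/
abbrev Pk (k : ℕ) : Type := Setoid (Fin k ⊕ Fin k)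

/-- The permutation `σ` as the partition with blocks `{i, σ(i)'}`. -/
def ofPerm {k : ℕ} (σ : Equiv.Perm (Fin k)) : Pk k := Setoid.ker (Sum.elim σ id)

/-- The partition `id_k`, with blocks `{i, i'}`. -/
def idPart (k : ℕ) : Pk k := ofPerm 1

/-- The diagram with three rows (top, middle, bottom) in which `q` joins the top and the middle
row and `p` joins the middle and the bottom row; the blocks are the connected components. -/
def stack {k : ℕ} (p q : Pk k) : Setoid (Fin k ⊕ (Fin k ⊕ Fin k)) :=
  q.map (Sum.map id Sum.inl) ⊔ p.map Sum.inr

/-- `p ∘ q`: put `q` above `p`, identify the lower row of `q` with the upper row of `p`, and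
erase the middle row. -/
def comp {k : ℕ} (p q : Pk k) : Pk k := (stack p q).comap (Sum.map id Sum.inr)

/-- `κ(p, q)`: the number of connected components of the three-row diagram that are entirely
contained in the middle row. -/
noncomputable def kappa {k : ℕ} (p q : Pk k) : ℕ :=
  Nat.card {c : Quotient (stack p q) // ∀ x, Quotient.mk _ x = c → ∃ j, x = Sum.inr (Sum.inl j)}

/-- A partition is irreducible if it has exactly one cycle, a cycle being a block of
`p ∨ id_k`. -/
def Irreducible {k : ℕ} (p : Pk k) : Prop := nc (p ⊔ idPart k) = 1

/-- The Kreweras complement `K_p(p')`. -/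
def kreweras {k : ℕ} (p p' : Pk k) : Set (Pk k) :=
  {p'' | p = comp p' p'' ∧
    d (idPart k) p = d (idPart k) p' + d (idPart k) p''
      - ((k : ℝ) + nc p - nc p' - nc p'') / 2 - kappa p' p''}

/-- Inclusion of the points of the left diagram in a juxtaposition of two diagrams. -/
def inL (k l : ℕ) : Fin k ⊕ Fin k → Fin (k + l) ⊕ Fin (k + l) :=
  Sum.map (Fin.castAdd l) (Fin.castAdd l)

/-- Inclusion of the points of the right diagram in a juxtaposition of two diagrams. -/
def inR (k l : ℕ) : Fin l ⊕ Fin l → Fin (k + l) ⊕ Fin (k + l) :=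
  Sum.map (Fin.natAdd k) (Fin.natAdd k)

theorem inL_injective (k l : ℕ) : Function.Injective (inL k l) :=
  Sum.map_injective.2 ⟨Fin.castAdd_injective k l, Fin.castAdd_injective k l⟩

theorem inR_injective (k l : ℕ) : Function.Injective (inR k l) :=
  Sum.map_injective.2 ⟨Fin.natAdd_injective l k, Fin.natAdd_injective l k⟩

theorem inL_ne_inR {k l : ℕ} (a : Fin k ⊕ Fin k) (b : Fin l ⊕ Fin l) : inL k l a ≠ inR k l b := by
  rcases a with a | a <;> rcases b with b | b <;> simp [inL, inR, Fin.ext_iff] <;> omega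

theorem inL_or_inR {k l : ℕ} (x : Fin (k + l) ⊕ Fin (k + l)) :
    (∃ a, x = inL k l a) ∨ ∃ b, x = inR k l b := by
  rcases x with x | x
  · refine Fin.addCases (fun i => Or.inl ⟨Sum.inl i, rfl⟩) (fun i => Or.inr ⟨Sum.inl i, rfl⟩) x
  · refine Fin.addCases (fun i => Or.inl ⟨Sum.inr i, rfl⟩) (fun i => Or.inr ⟨Sum.inr i, rfl⟩) x

/-- The tensor product `p ⊗ q`: the diagram of `p` is put on the left of the diagram of `q`. -/
def tensor {k l : ℕ} (p : Pk k) (q : Pk l) : Pk (k + l) where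
  r x y := (∃ a b, p a b ∧ x = inL k l a ∧ y = inL k l b) ∨
    ∃ a b, q a b ∧ x = inR k l a ∧ y = inR k l b
  iseqv :=
    { refl := fun x => (inL_or_inR x).imp (fun ⟨a, h⟩ => ⟨a, a, p.refl' a, h, h⟩)
        (fun ⟨a, h⟩ => ⟨a, a, q.refl' a, h, h⟩)
      symm := fun h => h.imp (fun ⟨a, b, h, ha, hb⟩ => ⟨b, a, p.symm' h, hb, ha⟩)
        (fun ⟨a, b, h, ha, hb⟩ => ⟨b, a, q.symm' h, hb, ha⟩)
      trans := by
        rintro x y z (⟨a, b, h, rfl, rfl⟩ | ⟨a, b, h, rfl, rfl⟩)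
          (⟨a', b', h', h1, rfl⟩ | ⟨a', b', h', h1, rfl⟩)
        · obtain rfl := inL_injective k l h1
          exact Or.inl ⟨a, b', p.trans' h h', rfl, rfl⟩
        · exact absurd h1 (inL_ne_inR _ _)
        · exact absurd h1.symm (inL_ne_inR _ _)
        · obtain rfl := inR_injective k l h1
          exact Or.inr ⟨a, b', q.trans' h h', rfl, rfl⟩ }

theorem tensor_inL_inL {k l : ℕ} (p : Pk k) (q : Pk l) (a b : Fin k ⊕ Fin k) :
    tensor p q (inL k l a) (inL k l b) ↔ p a b := by
  constructor
  · rintro (⟨a', b', h, h1, h2⟩ | ⟨a', b', h, h1, h2⟩)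
    · rwa [inL_injective k l h1, inL_injective k l h2]
    · exact absurd h1 (inL_ne_inR _ _)
  · exact fun h => Or.inl ⟨a, b, h, rfl, rfl⟩

theorem tensor_inR_inR {k l : ℕ} (p : Pk k) (q : Pk l) (a b : Fin l ⊕ Fin l) :
    tensor p q (inR k l a) (inR k l b) ↔ q a b := by
  constructor
  · rintro (⟨a', b', h, h1, h2⟩ | ⟨a', b', h, h1, h2⟩)
    · exact absurd h1.symm (inL_ne_inR _ _)
    · rwa [inR_injective k l h1, inR_injective k l h2]
  · exact fun h => Or.inr ⟨a, b, h, rfl, rfl⟩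

theorem not_tensor_inL_inR {k l : ℕ} (p : Pk k) (q : Pk l) (a : Fin k ⊕ Fin k)
    (b : Fin l ⊕ Fin l) : ¬ tensor p q (inL k l a) (inR k l b) := by
  rintro (⟨a', b', h, h1, h2⟩ | ⟨a', b', h, h1, h2⟩)
  · exact absurd h2.symm (inL_ne_inR _ _)
  · exact absurd h1 (inL_ne_inR _ _)

theorem not_tensor_inR_inL {k l : ℕ} (p : Pk k) (q : Pk l) (a : Fin k ⊕ Fin k)
    (b : Fin l ⊕ Fin l) : ¬ tensor p q (inR k l b) (inL k l a) :=
  fun h => not_tensor_inL_inR p q a b (Setoid.symm' _ h)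

/-! ### Relabelling and conjugation -/

/-- Relabelling of the columns along a bijection. -/
def relabel {k l : ℕ} (e : Fin k ≃ Fin l) (p : Pk k) : Pk l :=
  p.comap (Equiv.sumCongr e.symm e.symm)

theorem relabel_rel {k l : ℕ} (e : Fin k ≃ Fin l) (p : Pk k) (x y : Fin l ⊕ Fin l) :
    relabel e p x y ↔ p (Sum.map e.symm e.symm x) (Sum.map e.symm e.symm y) := Iff.rfl

theorem relabel_refl {k : ℕ} (p : Pk k) : relabel (Equiv.refl _) p = p := by
  ext x y
  rcases x with x | x <;> rcases y with y | y <;> simp [relabel_rel]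

theorem relabel_trans {k l m : ℕ} (e : Fin k ≃ Fin l) (f : Fin l ≃ Fin m) (p : Pk k) :
    relabel (e.trans f) p = relabel f (relabel e p) := by
  ext x y
  rcases x with x | x <;> rcases y with y | y <;> simp [relabel_rel]

theorem stack_le_iff {k : ℕ} (p q : Pk k) (s : Setoid (Fin k ⊕ (Fin k ⊕ Fin k))) :
    stack p q ≤ s ↔ q ≤ s.comap (Sum.map id Sum.inl) ∧ p ≤ s.comap Sum.inr := by
  have aux : ∀ (q : Pk k) (f : Fin k ⊕ Fin k → Fin k ⊕ (Fin k ⊕ Fin k)),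
      q.map f ≤ s ↔ q ≤ s.comap f := by
    intro q f
    constructor
    · intro h x y hxy
      exact h (Setoid.le_comap_map hxy)
    · intro h
      refine Setoid.eqvGen_le ?_
      rintro _ _ ⟨a, b, hab, rfl, rfl⟩
      exact h hab
  rw [stack, sup_le_iff, aux, aux]

theorem stack_top {k : ℕ} {p q : Pk k} {x y : Fin k ⊕ Fin k} (h : q x y) :
    stack p q (Sum.map id Sum.inl x) (Sum.map id Sum.inl y) :=
  ((stack_le_iff p q _).1 le_rfl).1 h

theorem stack_bot {k : ℕ} {p q : Pk k} {x y : Fin k ⊕ Fin k} (h : p x y) :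
    stack p q (Sum.inr x) (Sum.inr y) :=
  ((stack_le_iff p q _).1 le_rfl).2 h

theorem comp_ofPerm {k : ℕ} (p : Pk k) (τ : Equiv.Perm (Fin k)) :
    comp p (ofPerm τ) = p.comap (Sum.map τ id) := by
  have h : stack p (ofPerm τ) =
      p.comap (Sum.elim (fun i => Sum.inl (τ i)) id : Fin k ⊕ (Fin k ⊕ Fin k) → _) := by
    apply le_antisymm
    · rw [stack_le_iff]
      constructor
      · intro x y hxy
        have hxy' : Sum.elim τ id x = Sum.elim τ id y := hxy
        have : ∀ z : Fin k ⊕ Fin k, (Sum.elim (fun i => Sum.inl (τ i)) id : _ → Fin k ⊕ Fin k)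
            (Sum.map id Sum.inl z) = Sum.inl (Sum.elim τ id z) := by
          rintro (z | z) <;> rfl
        rw [Setoid.comap_rel, Setoid.comap_rel, this, this, hxy']
      · intro x y hxy
        exact hxy
    · have key : ∀ a : Fin k ⊕ (Fin k ⊕ Fin k),
          stack p (ofPerm τ) a (Sum.inr ((Sum.elim (fun i => Sum.inl (τ i)) id : _ → _) a)) := by
        rintro (a | a)
        · exact stack_top (x := Sum.inl a) (y := Sum.inr (τ a)) rfl
        · exact Setoid.refl' _ _
      intro a b hab
      exact Setoid.trans' _ (key a) (Setoid.trans' _ (stack_bot hab) (Setoid.symm' _ (key b)))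
  rw [comp, h]
  ext x y
  rcases x with x | x <;> rcases y with y | y <;> rfl

theorem ofPerm_comp {k : ℕ} (p : Pk k) (σ : Equiv.Perm (Fin k)) :
    comp (ofPerm σ) p = p.comap (Sum.map id σ.symm) := by
  have h : stack (ofPerm σ) p = p.comap
      (Sum.elim Sum.inl (Sum.elim Sum.inr fun j => Sum.inr (σ.symm j)) :
        Fin k ⊕ (Fin k ⊕ Fin k) → _) := by
    apply le_antisymm
    · rw [stack_le_iff]
      constructor
      · intro x y hxy
        rcases x with x | x <;> rcases y with y | y <;> exact hxy
      · intro x y hxy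
        have hxy' : Sum.elim σ id x = Sum.elim σ id y := hxy
        have : ∀ z : Fin k ⊕ Fin k,
            (Sum.elim Sum.inr (fun j => Sum.inr (σ.symm j)) : _ → Fin k ⊕ Fin k) z =
              Sum.inr (σ.symm (Sum.elim σ id z)) := by
          rintro (z | z) <;> simp
        rw [Setoid.comap_rel, Setoid.comap_rel, Sum.elim_inr, Sum.elim_inr, this, this, hxy']
    · have key : ∀ a : Fin k ⊕ (Fin k ⊕ Fin k), stack (ofPerm σ) p a (Sum.map id Sum.inl
          ((Sum.elim Sum.inl (Sum.elim Sum.inr fun j => Sum.inr (σ.symm j)) : _ → _) a)) := by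
        rintro (a | a | a)
        · exact Setoid.refl' _ _
        · exact Setoid.refl' _ _
        · refine stack_bot (x := Sum.inr a) (y := Sum.inl (σ.symm a)) ?_
          change a = σ (σ.symm a)
          simp
      intro a b hab
      exact Setoid.trans' _ (key a) (Setoid.trans' _ (stack_top hab) (Setoid.symm' _ (key b)))
  rw [comp, h]
  ext x y
  rcases x with x | x <;> rcases y with y | y <;> rfl

/-- Conjugation by a permutation is relabelling. -/
theorem conj_eq_relabel {k : ℕ} (σ : Equiv.Perm (Fin k)) (p : Pk k) :
    comp (comp (ofPerm σ) p) (ofPerm σ⁻¹) = relabel σ p := by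
  rw [comp_ofPerm, ofPerm_comp]
  ext x y
  rcases x with x | x <;> rcases y with y | y <;> rfl

theorem idPart_relabel {k l : ℕ} (e : Fin k ≃ Fin l) : relabel e (idPart k) = idPart l := by
  ext x y
  change Sum.elim _ _ (Sum.map e.symm e.symm x) = Sum.elim _ _ (Sum.map e.symm e.symm y) ↔
    Sum.elim _ _ x = Sum.elim _ _ y
  rcases x with x | x <;> rcases y with y | y <;> simp

theorem stack_relabel {k : ℕ} (e : Equiv.Perm (Fin k)) (p q : Pk k) :
    stack (relabel e p) (relabel e q) =
      (stack p q).comap (Equiv.sumCongr e.symm (Equiv.sumCongr e.symm e.symm)) := by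
  have le : ∀ (e : Equiv.Perm (Fin k)) (p q : Pk k), stack (relabel e p) (relabel e q) ≤
      (stack p q).comap (Equiv.sumCongr e.symm (Equiv.sumCongr e.symm e.symm)) := by
    intro e p q
    rw [stack_le_iff]
    constructor
    · intro x y h
      have h' : stack p q _ _ := stack_top (p := p)
        (show q (Sum.map e.symm e.symm x) (Sum.map e.symm e.symm y) from h)
      rcases x with x | x <;> rcases y with y | y <;> exact h'
    · intro x y h
      have h' : stack p q _ _ := stack_bot (q := q)
        (show p (Sum.map e.symm e.symm x) (Sum.map e.symm e.symm y) from h)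
      rcases x with x | x <;> rcases y with y | y <;> exact h'
  refine le_antisymm (le e p q) ?_
  have h := le e.symm (relabel e p) (relabel e q)
  rw [← relabel_trans, ← relabel_trans, Equiv.self_trans_symm, relabel_refl, relabel_refl] at h
  intro x y hxy
  have h' := h hxy
  rw [Setoid.comap_rel] at h'
  rcases x with x | x | x <;> rcases y with y | y | y <;> simpa using h'

theorem comp_relabel {k : ℕ} (e : Equiv.Perm (Fin k)) (p q : Pk k) :
    comp (relabel e p) (relabel e q) = relabel e (comp p q) := by
  rw [comp, stack_relabel]
  ext x y
  rcases x with x | x <;> rcases y with y | y <;> rfl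

theorem kappa_relabel {k : ℕ} (e : Equiv.Perm (Fin k)) (p q : Pk k) :
    kappa (relabel e p) (relabel e q) = kappa p q := by
  unfold kappa
  rw [stack_relabel]
  let f : Fin k ⊕ (Fin k ⊕ Fin k) ≃ Fin k ⊕ (Fin k ⊕ Fin k) :=
    Equiv.sumCongr e.symm (Equiv.sumCongr e.symm e.symm)
  refine Nat.card_congr (Equiv.subtypeEquiv
    (Quotient.congr (ra := (stack p q).comap f) (rb := stack p q) f fun _ _ => Iff.rfl) ?_)
  intro c
  induction c using Quotient.inductionOn with
  | _ c =>
  have hmid : ∀ x, (∃ j, f x = Sum.inr (Sum.inl j)) ↔ ∃ j, x = Sum.inr (Sum.inl j) := by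
    rintro (x | x | x) <;> simp [f]
  constructor
  · intro h x hx
    obtain ⟨y, rfl⟩ := f.surjective x
    exact (hmid y).2 (h y (Quotient.sound (Quotient.exact hx :)))
  · intro h x hx
    exact (hmid x).1 (h (f x) (Quotient.sound (Quotient.exact hx :)))

theorem kreweras_relabel {k : ℕ} (e : Equiv.Perm (Fin k)) {p p' p'' : Pk k}
    (h : p'' ∈ kreweras p p') : relabel e p'' ∈ kreweras (relabel e p) (relabel e p') := by
  obtain ⟨h1, h2⟩ := h
  have hd : ∀ q : Pk k, d (idPart k) (relabel e q) = d (idPart k) q := by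
    intro q
    conv_lhs => rw [← idPart_relabel e]
    exact d_comap _ _ _
  have hn : ∀ q : Pk k, nc (relabel e q) = nc q := fun q => nc_comap _ _
  refine ⟨by rw [comp_relabel, ← h1], ?_⟩
  rw [hd, hd, hd, hn, hn, hn, kappa_relabel]
  exact h2

/-! ### Orbits and their product -/

/-- Conjugation of partitions by permutations. -/
def conjSetoid (k : ℕ) : Setoid (Pk k) where
  r p p' := ∃ σ : Equiv.Perm (Fin k), p' = comp (comp (ofPerm σ) p) (ofPerm σ⁻¹)
  iseqv :=
    { refl := fun p => ⟨1, by rw [conj_eq_relabel]; exact (relabel_refl p).symm⟩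
      symm := by
        rintro p _ ⟨σ, rfl⟩
        refine ⟨σ⁻¹, ?_⟩
        rw [conj_eq_relabel, conj_eq_relabel, ← relabel_trans]
        exact (Equiv.self_trans_symm σ ▸ relabel_refl p).symm
      trans := by
        rintro p _ _ ⟨σ, rfl⟩ ⟨τ, rfl⟩
        refine ⟨τ * σ, ?_⟩
        rw [conj_eq_relabel, conj_eq_relabel, conj_eq_relabel, ← relabel_trans]
        rfl }

/-- The disjoint union over `k` of the orbit sets `𝒫_k / 𝔖_k`. -/
def Orb : Type := Σ k : ℕ, Quotient (conjSetoid k)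

/-- The orbit `[p]`. -/
def mk {k : ℕ} (p : Pk k) : Orb := ⟨k, Quotient.mk _ p⟩

/-- The degree: `dg [p] = k` if `p ∈ 𝒫_k`. -/
def dg (x : Orb) : ℕ := x.1

theorem mk_eq_iff {k l : ℕ} {p : Pk k} {q : Pk l} :
    mk p = mk q ↔ ∃ e : Fin k ≃ Fin l, q = relabel e p := by
  constructor
  · intro h
    obtain rfl : k = l := congrArg dg h
    have h' : Quotient.mk (conjSetoid k) p = Quotient.mk (conjSetoid k) q :=
      eq_of_heq (Sigma.mk.inj h).2
    obtain ⟨σ, hσ⟩ := Quotient.exact h'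
    exact ⟨σ, by rw [hσ, conj_eq_relabel]⟩
  · rintro ⟨e, rfl⟩
    obtain rfl : k = l := by simpa using Fintype.card_congr e
    exact congrArg (Sigma.mk k) (Quotient.sound ⟨e, (conj_eq_relabel e p).symm⟩)

theorem mk_surjective (x : Orb) : ∃ (k : ℕ) (p : Pk k), x = mk p := by
  obtain ⟨k, x⟩ := x
  induction x using Quotient.inductionOn with
  | _ p => exact ⟨k, p, rfl⟩

/-- Lifting a function of partitions to orbits. -/
def Orb.lift {β : Type*} (f : ∀ k : ℕ, Pk k → β)
    (h : ∀ k (e : Equiv.Perm (Fin k)) (p : Pk k), f k (relabel e p) = f k p) (x : Orb) : β :=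
  Quotient.lift (f x.1) (by
    rintro p _ ⟨σ, rfl⟩
    rw [conj_eq_relabel, h]) x.2

/-- A criterion for equality of orbits of two tensor products. -/
theorem mk_eq_of_rel {k l : ℕ} {p : Pk k} {q : Pk l} (e : Fin k ≃ Fin l)
    (h : ∀ x y, p x y ↔ q (Sum.map e e x) (Sum.map e e y)) : mk p = mk q := by
  refine mk_eq_iff.2 ⟨e, ?_⟩
  ext x y
  rw [relabel_rel, h]
  rcases x with x | x <;> rcases y with y | y <;> simp

theorem rel_of_mk_eq {k l : ℕ} {p : Pk k} {q : Pk l} (h : mk p = mk q) :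
    ∃ e : Fin k ≃ Fin l, ∀ x y, p x y ↔ q (Sum.map e e x) (Sum.map e e y) := by
  obtain ⟨e, rfl⟩ := mk_eq_iff.1 h
  refine ⟨e, fun x y => ?_⟩
  rw [relabel_rel]
  rcases x with x | x <;> rcases y with y | y <;> simp

theorem tensor_congr {k l k' l' : ℕ} {p : Pk k} {q : Pk l} {p' : Pk k'} {q' : Pk l'}
    (hp : mk p = mk p') (hq : mk q = mk q') : mk (tensor p q) = mk (tensor p' q') := by
  obtain ⟨e, he⟩ := rel_of_mk_eq hp
  obtain ⟨f, hf⟩ := rel_of_mk_eq hq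
  let g : Fin (k + l) ≃ Fin (k' + l') :=
    finSumFinEquiv.symm.trans ((Equiv.sumCongr e f).trans finSumFinEquiv)
  have gL : ∀ a, Sum.map g g (inL k l a) = inL k' l' (Sum.map e e a) := by
    rintro (a | a) <;> simp [g, inL]
  have gR : ∀ a, Sum.map g g (inR k l a) = inR k' l' (Sum.map f f a) := by
    rintro (a | a) <;> simp [g, inR]
  refine mk_eq_of_rel g fun x y => ?_
  rcases inL_or_inR x with ⟨x, rfl⟩ | ⟨x, rfl⟩ <;> rcases inL_or_inR y with ⟨y, rfl⟩ | ⟨y, rfl⟩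
  · rw [gL, gL, tensor_inL_inL, tensor_inL_inL, he]
  · rw [gL, gR]
    exact iff_of_false (not_tensor_inL_inR _ _ _ _) (not_tensor_inL_inR _ _ _ _)
  · rw [gL, gR]
    exact iff_of_false (not_tensor_inR_inL _ _ _ _) (not_tensor_inR_inL _ _ _ _)
  · rw [gR, gR, tensor_inR_inR, tensor_inR_inR, hf]

/-- The product of orbits: `[p] * [q] = [p ⊗ q]`. -/
def Orb.mul (x y : Orb) : Orb :=
  Orb.lift (fun _ p => Orb.lift (fun _ q => mk (tensor p q))
      (fun _ e _ => tensor_congr rfl (mk_eq_iff.2 ⟨e, rfl⟩).symm) y)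
    (fun _ e _ => by
      obtain ⟨l, q, rfl⟩ := mk_surjective y
      exact tensor_congr (mk_eq_iff.2 ⟨e, rfl⟩).symm rfl) x

theorem mul_mk {k l : ℕ} (p : Pk k) (q : Pk l) : (mk p).mul (mk q) = mk (tensor p q) := rfl

theorem mk_tensor_assoc {k l m : ℕ} (p : Pk k) (q : Pk l) (r : Pk m) :
    mk (tensor (tensor p q) r) = mk (tensor p (tensor q r)) := by
  let g : Fin (k + l + m) ≃ Fin (k + (l + m)) := finCongr (Nat.add_assoc k l m)
  have g1 : ∀ a, Sum.map g g (inL (k + l) m (inL k l a)) = inL k (l + m) a := by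
    rintro (a | a) <;> simp [g, inL, Fin.ext_iff]
  have g2 : ∀ a, Sum.map g g (inL (k + l) m (inR k l a)) = inR k (l + m) (inL l m a) := by
    rintro (a | a) <;> simp [g, inL, inR, Fin.ext_iff]
  have g3 : ∀ a, Sum.map g g (inR (k + l) m a) = inR k (l + m) (inR l m a) := by
    rintro (a | a) <;> simp [g, inR, Fin.ext_iff, Nat.add_assoc]
  have cases3 : ∀ x : Fin (k + l + m) ⊕ Fin (k + l + m),
      (∃ a, x = inL (k + l) m (inL k l a)) ∨ (∃ a, x = inL (k + l) m (inR k l a)) ∨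
        ∃ a, x = inR (k + l) m a := by
    intro x
    rcases inL_or_inR x with ⟨x, rfl⟩ | ⟨x, rfl⟩
    · rcases inL_or_inR x with ⟨x, rfl⟩ | ⟨x, rfl⟩
      · exact Or.inl ⟨x, rfl⟩
      · exact Or.inr (Or.inl ⟨x, rfl⟩)
    · exact Or.inr (Or.inr ⟨x, rfl⟩)
  refine mk_eq_of_rel g fun x y => ?_
  rcases cases3 x with ⟨x, rfl⟩ | ⟨x, rfl⟩ | ⟨x, rfl⟩ <;>
    rcases cases3 y with ⟨y, rfl⟩ | ⟨y, rfl⟩ | ⟨y, rfl⟩ <;>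
    simp only [g1, g2, g3, tensor_inL_inL, tensor_inR_inR, not_tensor_inL_inR, not_tensor_inR_inL]

theorem mk_tensor_comm {k l : ℕ} (p : Pk k) (q : Pk l) :
    mk (tensor p q) = mk (tensor q p) := by
  let g : Fin (k + l) ≃ Fin (l + k) :=
    finSumFinEquiv.symm.trans ((Equiv.sumComm _ _).trans finSumFinEquiv)
  have gL : ∀ a, Sum.map g g (inL k l a) = inR l k a := by
    rintro (a | a) <;> simp [g, inL, inR]
  have gR : ∀ a, Sum.map g g (inR k l a) = inL l k a := by
    rintro (a | a) <;> simp [g, inL, inR]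
  refine mk_eq_of_rel g fun x y => ?_
  rcases inL_or_inR x with ⟨x, rfl⟩ | ⟨x, rfl⟩ <;> rcases inL_or_inR y with ⟨y, rfl⟩ | ⟨y, rfl⟩ <;>
    simp only [gL, gR, tensor_inL_inL, tensor_inR_inR, not_tensor_inL_inR, not_tensor_inR_inL]

theorem mk_empty_tensor {k : ℕ} (p : Pk k) : mk (tensor (idPart 0) p) = mk p := by
  let g : Fin (0 + k) ≃ Fin k := finCongr (Nat.zero_add k)
  have gR : ∀ a, Sum.map g g (inR 0 k a) = a := by
    rintro (a | a) <;> simp [g, inR, Fin.ext_iff]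
  refine mk_eq_of_rel g fun x y => ?_
  rcases inL_or_inR x with ⟨x, rfl⟩ | ⟨x, rfl⟩
  · rcases x with x | x <;> exact x.elim0
  rcases inL_or_inR y with ⟨y, rfl⟩ | ⟨y, rfl⟩
  · rcases y with y | y <;> exact y.elim0
  rw [tensor_inR_inR, gR, gR]

/-- `⋃_k 𝒫_k / 𝔖_k` with the product `[p] * [q] = [p ⊗ q]` and the neutral element `[∅]`, where
`∅ = id_0` is the only element of `𝒫_0`. -/
instance : CommMonoid Orb where
  mul := Orb.mul
  one := mk (idPart 0)
  mul_assoc x y z := by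
    obtain ⟨k, p, rfl⟩ := mk_surjective x
    obtain ⟨l, q, rfl⟩ := mk_surjective y
    obtain ⟨m, r, rfl⟩ := mk_surjective z
    exact mk_tensor_assoc p q r
  one_mul x := by
    obtain ⟨k, p, rfl⟩ := mk_surjective x
    exact mk_empty_tensor p
  mul_one x := by
    obtain ⟨k, p, rfl⟩ := mk_surjective x
    exact (mk_tensor_comm p (idPart 0)).trans (mk_empty_tensor p)
  mul_comm x y := by
    obtain ⟨k, p, rfl⟩ := mk_surjective x
    obtain ⟨l, q, rfl⟩ := mk_surjective y
    exact mk_tensor_comm p q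

/-! ### The algebra `⨁_k ℂ[𝒫_k / 𝔖_k]` -/

/-- The vector space `⨁_k ℂ[𝒫_k / 𝔖_k]`, that is, the vector space with basis
`⋃_k 𝒫_k / 𝔖_k`, with the bilinear extension of `[p] * [q] = [p ⊗ q]`. -/
abbrev PAlg : Type := MonoidAlgebra ℂ Orb

/-- The basis vector of `⨁_k ℂ[𝒫_k / 𝔖_k]` given by an orbit. -/
noncomputable abbrev vec (x : Orb) : PAlg := MonoidAlgebra.of ℂ Orb x

/-- The summand `ℂ[𝒫_k / 𝔖_k]`. -/
noncomputable def component (k : ℕ) : Submodule ℂ PAlg :=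
  Submodule.span ℂ {v | ∃ p : Pk k, v = vec (mk p)}

/-- Extension by linearity of a function on orbits. -/
noncomputable def linExt {V : Type*} [AddCommMonoid V] [Module ℂ V] (f : Orb → V) :
    PAlg →ₗ[ℂ] V :=
  (MonoidAlgebra.basis Orb ℂ).constr ℂ f

theorem linExt_vec {V : Type*} [AddCommMonoid V] [Module ℂ V] (f : Orb → V) (x : Orb) :
    linExt f (vec x) = f x := by
  have h := (MonoidAlgebra.basis Orb ℂ).constr_basis ℂ f x
  rwa [MonoidAlgebra.basis_apply] at h

/-! ### The coproduct `Δ_⊞` and its counit -/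

/-- The set of columns `J` is a union of cycles of `p` (restricted to the upper row). -/
def IsUnionOfCycles {k : ℕ} (p : Pk k) (J : Finset (Fin k)) : Prop :=
  ∀ i j, (p ⊔ idPart k) (Sum.inl i) (Sum.inl j) → (i ∈ J ↔ j ∈ J)

/-- The extraction of `p` to the columns in `J`, which are relabelled from left to right. -/
def extract {k : ℕ} (p : Pk k) (J : Finset (Fin k)) : Pk J.card :=
  p.comap (Sum.map (J.orderEmbOfFin rfl) (J.orderEmbOfFin rfl))

theorem isUnionOfCycles_relabel {k : ℕ} (e : Equiv.Perm (Fin k)) {p : Pk k} {J : Finset (Fin k)}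
    (h : IsUnionOfCycles p J) : IsUnionOfCycles (relabel e p) (J.map e.toEmbedding) := by
  have hle : relabel e p ⊔ idPart k ≤ relabel e (p ⊔ idPart k) := by
    refine sup_le (fun _ _ hxy => (le_sup_left : p ≤ p ⊔ idPart k) hxy) ?_
    have h : relabel e (idPart k) ≤ relabel e (p ⊔ idPart k) :=
      fun _ _ hxy => (le_sup_right : idPart k ≤ p ⊔ idPart k) hxy
    rwa [idPart_relabel e] at h
  intro i j hij
  have := h (e.symm i) (e.symm j) (hle hij)
  simpa [Finset.mem_map_equiv] using this

theorem mk_extract_relabel {k : ℕ} (e : Equiv.Perm (Fin k)) (p : Pk k) (J : Finset (Fin k)) :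
    mk (extract (relabel e p) (J.map e.toEmbedding)) = mk (extract p J) := by
  let a := J.orderIsoOfFin rfl
  let b := (J.map e.toEmbedding).orderIsoOfFin rfl
  let g : Fin (J.map e.toEmbedding).card ≃ Fin J.card :=
    b.toEquiv.trans ((e.symm.subtypeEquiv (by intro x; simp [Finset.mem_map_equiv])).trans
      a.symm.toEquiv)
  have hg : ∀ i, J.orderEmbOfFin rfl (g i) =
      e.symm ((J.map e.toEmbedding).orderEmbOfFin rfl i) := by
    intro i
    rw [← Finset.coe_orderIsoOfFin_apply, ← Finset.coe_orderIsoOfFin_apply]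
    simp [g, a, b]
  refine mk_eq_of_rel g fun x y => ?_
  change p (Sum.map e.symm e.symm (Sum.map _ _ x)) (Sum.map e.symm e.symm (Sum.map _ _ y)) ↔
    p (Sum.map (J.orderEmbOfFin rfl) (J.orderEmbOfFin rfl) (Sum.map g g x))
      (Sum.map (J.orderEmbOfFin rfl) (J.orderEmbOfFin rfl) (Sum.map g g y))
  rcases x with x | x <;> rcases y with y | y <;> simp only [Sum.map_inl, Sum.map_inr, hg]

open Classical in
/-- The value of `Δ_⊞` on an orbit: `∑ [p_J] ⊗ [p_{Jᶜ}]` over the unions `J` of cycles of `p`,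
where `p_J` is the extraction of `p` to `J`. For `p = p₁ ⊗ ⋯ ⊗ p_r` with irreducible `p_i`, these
are the `2^r` splittings of the family of factors. -/
noncomputable def deltaPlusOrb : Orb → PAlg ⊗[ℂ] PAlg :=
  Orb.lift (fun _ p => ∑ J with IsUnionOfCycles p J,
      vec (mk (extract p J)) ⊗ₜ[ℂ] vec (mk (extract p Jᶜ))) (by
    intro k e p
    symm
    refine Finset.sum_bij (fun J _ => J.map e.toEmbedding) ?_ ?_ ?_ ?_
    · intro J hJ
      simp only [Finset.mem_filter, Finset.mem_univ, true_and] at hJ ⊢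
      exact isUnionOfCycles_relabel e hJ
    · intro J _ J' _ h
      exact Finset.map_injective _ h
    · intro J hJ
      simp only [Finset.mem_filter, Finset.mem_univ, true_and] at hJ
      refine ⟨J.map e.symm.toEmbedding, ?_, ?_⟩
      · have h := isUnionOfCycles_relabel e.symm hJ
        rw [← relabel_trans, Equiv.self_trans_symm, relabel_refl] at h
        simpa using h
      · ext i
        simp [Finset.mem_map_equiv]
    · intro J _
      have hc : (J.map e.toEmbedding)ᶜ = Jᶜ.map e.toEmbedding := by
        ext i
        simp [Finset.mem_map_equiv]
      rw [hc, mk_extract_relabel, mk_extract_relabel])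

/-- The coproduct `Δ_⊞`. -/
noncomputable def deltaPlus : PAlg →ₗ[ℂ] PAlg ⊗[ℂ] PAlg := linExt deltaPlusOrb

open Classical in
theorem deltaPlus_vec_mk {k : ℕ} (p : Pk k) :
    deltaPlus (vec (mk p)) = ∑ J with IsUnionOfCycles p J,
      vec (mk (extract p J)) ⊗ₜ[ℂ] vec (mk (extract p Jᶜ)) :=
  linExt_vec _ _

open Classical in
/-- The counit `ε_⊞`, which sends `[∅]` to `1` and every other orbit to `0`. -/
noncomputable def counitPlus : PAlg →ₗ[ℂ] ℂ :=
  linExt fun x => if x = mk (idPart 0) then 1 else 0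

/-! ### The coproduct `Δ_⊠` and its counit -/

open Classical in
noncomputable instance (k : ℕ) : Fintype (Pk k) := Fintype.ofFinite _

open Classical in
/-- The value of `Δ_⊠` on an orbit: `∑ [p₁] ⊗ [p₂]` over the pairs with `p₁ ∘ p₂ = p` and
`p₂ ∈ K_p(p₁)`. -/
noncomputable def deltaTimesOrb : Orb → PAlg ⊗[ℂ] PAlg :=
  Orb.lift (fun k p => ∑ c : Pk k × Pk k with comp c.1 c.2 = p ∧ c.2 ∈ kreweras p c.1,
      vec (mk c.1) ⊗ₜ[ℂ] vec (mk c.2)) (by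
    intro k e p
    symm
    have hinv : ∀ q : Pk k, relabel e (relabel e.symm q) = q := by
      intro q
      rw [← relabel_trans, Equiv.symm_trans_self, relabel_refl]
    have hinv' : ∀ q : Pk k, relabel e.symm (relabel e q) = q := by
      intro q
      rw [← relabel_trans, Equiv.self_trans_symm, relabel_refl]
    refine Finset.sum_bij (fun c _ => (relabel e c.1, relabel e c.2)) ?_ ?_ ?_ ?_
    · intro c hc
      simp only [Finset.mem_filter, Finset.mem_univ, true_and] at hc ⊢
      exact ⟨by rw [comp_relabel, hc.1], kreweras_relabel e hc.2⟩
    · intro c _ c' _ h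
      have h1 := congrArg (relabel e.symm) (Prod.mk.inj h).1
      have h2 := congrArg (relabel e.symm) (Prod.mk.inj h).2
      rw [hinv', hinv'] at h1 h2
      exact Prod.ext h1 h2
    · intro c hc
      simp only [Finset.mem_filter, Finset.mem_univ, true_and] at hc
      refine ⟨(relabel e.symm c.1, relabel e.symm c.2), ?_, ?_⟩
      · simp only [Finset.mem_filter, Finset.mem_univ, true_and]
        have h := kreweras_relabel e.symm hc.2
        rw [hinv'] at h
        exact ⟨by rw [comp_relabel, hc.1, hinv'], h⟩
      · exact Prod.ext (hinv _) (hinv _)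
    · intro c _
      have h : ∀ q : Pk k, mk (relabel e q) = mk q := fun q => (mk_eq_iff.2 ⟨e, rfl⟩).symm
      rw [h, h])

/-- The coproduct `Δ_⊠`. -/
noncomputable def deltaTimes : PAlg →ₗ[ℂ] PAlg ⊗[ℂ] PAlg := linExt deltaTimesOrb

open Classical in
theorem deltaTimes_vec_mk {k : ℕ} (p : Pk k) :
    deltaTimes (vec (mk p)) = ∑ c : Pk k × Pk k with comp c.1 c.2 = p ∧ c.2 ∈ kreweras p c.1,
      vec (mk c.1) ⊗ₜ[ℂ] vec (mk c.2) :=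
  linExt_vec _ _

open Classical in
/-- The counit `ε_⊠`, which sends `[id_k]` to `1` for every `k` and every other orbit to `0`. -/
noncomputable def counitTimes : PAlg →ₗ[ℂ] ℂ :=
  linExt fun x => if ∃ k, x = mk (idPart k) then 1 else 0

/-! ### Bialgebras and graded connected Hopf algebras -/

/-- The associative unital algebra `A` is a (coassociative, counital) bialgebra with the coproduct
`Δ` and the counit `ε`. -/
structure IsBialgebra {R A : Type*} [CommRing R] [Ring A] [Algebra R A]
    (Δ : A →ₗ[R] A ⊗[R] A) (ε : A →ₗ[R] R) : Prop where
  coassoc : TensorProduct.assoc R A A A ∘ₗ Δ.rTensor A ∘ₗ Δ = Δ.lTensor A ∘ₗ Δ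
  counit_left : ε.rTensor A ∘ₗ Δ = TensorProduct.mk R _ _ 1
  counit_right : ε.lTensor A ∘ₗ Δ = (TensorProduct.mk R _ _).flip 1
  counit_one : ε 1 = 1
  counit_mul : ∀ a b, ε (a * b) = ε a * ε b
  comul_one : Δ 1 = 1
  comul_mul : ∀ a b, Δ (a * b) = Δ a * Δ b

/-- The bialgebra in the sense of Mathlib. -/
@[reducible] def IsBialgebra.toBialgebra {R A : Type*} [CommRing R] [Ring A] [Algebra R A]
    {Δ : A →ₗ[R] A ⊗[R] A} {ε : A →ₗ[R] R} (h : IsBialgebra Δ ε) : Bialgebra R A :=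
  @Bialgebra.mk' R A _ _ _
    { comul := Δ
      counit := ε
      coassoc := h.coassoc
      rTensor_counit_comp_comul := h.counit_left
      lTensor_counit_comp_comul := h.counit_right }
    h.counit_one (h.counit_mul _ _) h.comul_one (h.comul_mul _ _)

/-- The algebra `A` with the coproduct `Δ`, the counit `ε` and the family `𝒜` of subspaces is a
graded connected Hopf algebra: it is a bialgebra, `A` is the direct sum of the `𝒜 n`, the product,
the unit, the coproduct, the counit are homogeneous of degree `0`, `𝒜 0` is the line spanned by
the unit, and there is an antipode, which is homogeneous of degree `0`. -/
structure IsGradedConnectedHopfAlgebra {R A : Type*} [CommRing R] [Ring A] [Algebra R A]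
    (𝒜 : ℕ → Submodule R A) (Δ : A →ₗ[R] A ⊗[R] A) (ε : A →ₗ[R] R) : Prop
    extends IsBialgebra Δ ε where
  isInternal : DirectSum.IsInternal 𝒜
  gradedMonoid : SetLike.GradedMonoid 𝒜
  comul_mem : ∀ n, ∀ a ∈ 𝒜 n, Δ a ∈ ⨆ c ∈ Finset.HasAntidiagonal.antidiagonal n,
    LinearMap.range (TensorProduct.map (𝒜 c.1).subtype (𝒜 c.2).subtype)
  counit_eq_zero : ∀ n, n ≠ 0 → ∀ a ∈ 𝒜 n, ε a = 0
  connected : 𝒜 0 = Submodule.span R {1}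
  exists_antipode : ∃ S : A →ₗ[R] A,
    LinearMap.mul' R A ∘ₗ S.rTensor A ∘ₗ Δ = Algebra.linearMap R A ∘ₗ ε ∧
    LinearMap.mul' R A ∘ₗ S.lTensor A ∘ₗ Δ = Algebra.linearMap R A ∘ₗ ε ∧
    ∀ n, ∀ a ∈ 𝒜 n, S a ∈ 𝒜 n

end SetPartition

/-! The coproduct `Δ_⊠` is handled by linearizing partitions. To `p` one attaches the rational
functions that are constant on its blocks, read as a linear relation `toRel p` between the values on
the upper and on the lower row. All the combinatorial numbers become dimensions: `nc p` is the
dimension of the relation (`finrank_toRel`), `κ` that of the space of middle vectors related to zero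
on both sides (`finrank_mid`), the number of cycles that of the space of vectors related to
themselves (`finrank_fix`), and `∘` becomes composition of relations (`toRel_comp`). Since `d(p, q)
= (nc p + nc q)/2 - nc(p ∨ q)` (`d_eq`), the Kreweras condition says exactly that an integer, the
excess of the pair, is zero (`mem_kreweras_iff`).

For arbitrary linear relations the excess is a sum of two nonnegative differences of dimensions
(`LinRel.excess_eq`) and satisfies a 2-cocycle identity (`LinRel.excess_cocycle`). Hence for a
triple the two excesses vanish in one bracketing exactly when they vanish in the other, which is the
coassociativity of `Δ_⊠`. Zero excess also forces the fixed space of the composition to be the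
intersection of the two fixed spaces. The indicator of the left columns is fixed by `p ⊗ q`, so it
is fixed by both members of a geodesic factorization of `p ⊗ q`; these therefore split as
juxtapositions (`sum_factorizations_tensor`), and `Δ_⊠` is multiplicative.

For `Δ_⊞`, a union of cycles of `p ⊗ q` is an independent choice on each side, so `Δ_⊞` is a
homomorphism of algebras (`deltaPlus_tensor`). Irreducible orbits are primitive
(`deltaPlus_irreducible`) and generate the algebra (`closure_irreducible`), so each axiom is an
identity of algebra homomorphisms to be checked on primitive generators. The antipode multiplies an
orbit by `-1` to the number of its cycles. -/

namespace SetPartition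

/-! ### Linear relations -/

namespace LinRel

variable {K V : Type*} [Field K] [AddCommGroup V] [Module K V]

/-- The composition of two linear relations on `V`: first `S`, then `R`. -/
def comp (R S : Submodule K (V × V)) : Submodule K (V × V) where
  carrier := {x | ∃ b, (x.1, b) ∈ S ∧ (b, x.2) ∈ R}
  add_mem' := by
    rintro x y ⟨b, h1, h2⟩ ⟨c, h3, h4⟩
    exact ⟨b + c, S.add_mem h1 h3, R.add_mem h2 h4⟩
  zero_mem' := ⟨0, S.zero_mem, R.zero_mem⟩
  smul_mem' := by
    rintro a x ⟨b, h1, h2⟩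
    refine ⟨a • b, ?_, ?_⟩
    · simpa using S.smul_mem a h1
    · simpa using R.smul_mem a h2

theorem mem_comp {R S : Submodule K (V × V)} {a c : V} :
    (a, c) ∈ comp R S ↔ ∃ b, (a, b) ∈ S ∧ (b, c) ∈ R := Iff.rfl

theorem comp_assoc (R S T : Submodule K (V × V)) : comp (comp R S) T = comp R (comp S T) := by
  ext ⟨a, d⟩
  simp only [mem_comp]
  constructor
  · rintro ⟨b, h1, c, h2, h3⟩
    exact ⟨c, ⟨b, h1, h2⟩, h3⟩
  · rintro ⟨c, ⟨b, h1, h2⟩, h3⟩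
    exact ⟨b, h1, c, h2, h3⟩

/-- The vectors in the middle that are related to zero on both sides. -/
def mid (R S : Submodule K (V × V)) : Submodule K V :=
  S.comap (LinearMap.inr K V V) ⊓ R.comap (LinearMap.inl K V V)

theorem mem_mid {R S : Submodule K (V × V)} {b : V} :
    b ∈ mid R S ↔ (0, b) ∈ S ∧ (b, 0) ∈ R := Iff.rfl

/-- The vectors related to themselves. -/
def fix (R : Submodule K (V × V)) : Submodule K V :=
  R.comap (LinearMap.prod LinearMap.id LinearMap.id)

theorem mem_fix {R : Submodule K (V × V)} {b : V} : b ∈ fix R ↔ (b, b) ∈ R := Iff.rfl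

theorem fix_inf_fix_le (R S : Submodule K (V × V)) : fix R ⊓ fix S ≤ fix (comp R S) :=
  fun b hb => ⟨b, hb.2, hb.1⟩

/-- Rank-nullity for the restriction of `f` to `S`, the tool behind most of the dimension counts
below. -/
theorem finrank_map_add_finrank_inf_ker {W : Type*} [AddCommGroup W] [Module K W]
    [FiniteDimensional K V] (f : V →ₗ[K] W) (S : Submodule K V) :
    Module.finrank K (S.map f) + Module.finrank K ↥(S ⊓ LinearMap.ker f) = Module.finrank K S := by
  have h := LinearMap.finrank_range_add_finrank_ker (f.domRestrict S)
  rw [LinearMap.range_domRestrict] at h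
  rw [← h, LinearMap.ker_domRestrict, ← Submodule.map_comap_subtype, Submodule.finrank_map_subtype_eq]

theorem finrank_map_of_injective {W : Type*} [AddCommGroup W] [Module K W] {f : V →ₗ[K] W}
    (hf : Function.Injective f) (S : Submodule K V) :
    Module.finrank K (S.map f) = Module.finrank K S :=
  (Submodule.equivMapOfInjective f hf S).finrank_eq.symm

theorem finrank_submodule_prod {W : Type*} [AddCommGroup W] [Module K W] [FiniteDimensional K V]
    [FiniteDimensional K W] (S : Submodule K V) (T : Submodule K W) :
    Module.finrank K (S.prod T) = Module.finrank K S + Module.finrank K T := by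
  have h := finrank_map_add_finrank_inf_ker (LinearMap.fst K V W) (S.prod T)
  have e : S.prod T ⊓ LinearMap.ker (LinearMap.fst K V W) = T.map (LinearMap.inr K V W) := by
    ext ⟨a, b⟩
    constructor
    · rintro ⟨⟨_, h⟩, rfl⟩
      exact ⟨b, h, rfl⟩
    · rintro ⟨b, hb, h⟩
      obtain ⟨rfl, rfl⟩ := Prod.mk.inj h
      exact ⟨⟨S.zero_mem, hb⟩, rfl⟩
  rw [Submodule.prod_map_fst, e, finrank_map_of_injective LinearMap.inr_injective] at h
  exact h.symm

variable [FiniteDimensional K V]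

/-- Rank-nullity twice on pairs in `S × R`. The difference `φ` of the two middle entries has the
third space as its image and the composable pairs as its kernel; the map `ψ` to the outer entries
sends the composable pairs onto the composition, with kernel a copy of `mid R S`. -/
theorem finrank_comp_add (R S : Submodule K (V × V)) :
    Module.finrank K (comp R S) + Module.finrank K (mid R S) +
      Module.finrank K ↥(R.map (LinearMap.fst K V V) ⊔ S.map (LinearMap.snd K V V)) =
    Module.finrank K R + Module.finrank K S := by
  let φ : (V × V) × (V × V) →ₗ[K] V :=
    LinearMap.snd K V V ∘ₗ LinearMap.fst K _ _ - LinearMap.fst K V V ∘ₗ LinearMap.snd K _ _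
  let ψ : (V × V) × (V × V) →ₗ[K] V × V :=
    (LinearMap.fst K V V).prodMap (LinearMap.snd K V V)
  let ι : V →ₗ[K] (V × V) × (V × V) := (LinearMap.inr K V V).prod (LinearMap.inl K V V)
  have hι : Function.Injective ι := by
    intro a b h
    simpa [ι] using h
  have h1 := finrank_map_add_finrank_inf_ker φ (S.prod R)
  have h2 := finrank_map_add_finrank_inf_ker ψ (S.prod R ⊓ LinearMap.ker φ)
  have e1 : (S.prod R).map φ = R.map (LinearMap.fst K V V) ⊔ S.map (LinearMap.snd K V V) := by
    apply le_antisymm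
    · rintro _ ⟨⟨s, r⟩, ⟨hs, hr⟩, rfl⟩
      refine Submodule.sub_mem _ ?_ ?_
      · exact Submodule.mem_sup_right ⟨s, hs, rfl⟩
      · exact Submodule.mem_sup_left ⟨r, hr, rfl⟩
    · refine sup_le ?_ ?_
      · rintro _ ⟨r, hr, rfl⟩
        exact ⟨(0, -r), ⟨S.zero_mem, R.neg_mem hr⟩, by simp [φ]⟩
      · rintro _ ⟨s, hs, rfl⟩
        exact ⟨(s, 0), ⟨hs, R.zero_mem⟩, by simp [φ]⟩
  have e2 : (S.prod R ⊓ LinearMap.ker φ).map ψ = comp R S := by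
    ext ⟨a, c⟩
    constructor
    · rintro ⟨⟨⟨a, b⟩, ⟨b', c⟩⟩, ⟨⟨hs, hr⟩, hk⟩, h⟩
      obtain rfl : b = b' := by simpa [φ, sub_eq_zero] using hk
      simp only [ψ, LinearMap.prodMap_apply, LinearMap.fst_apply, LinearMap.snd_apply] at h
      obtain ⟨rfl, rfl⟩ := Prod.mk.inj h
      exact ⟨b, hs, hr⟩
    · rintro ⟨b, h1, h2⟩
      exact ⟨((a, b), (b, c)), ⟨⟨h1, h2⟩, by simp [φ]⟩, rfl⟩
  have e3 : S.prod R ⊓ LinearMap.ker φ ⊓ LinearMap.ker ψ = (mid R S).map ι := by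
    ext x
    constructor
    · obtain ⟨⟨a, b⟩, ⟨b', c⟩⟩ := x
      rintro ⟨⟨⟨hs, hr⟩, hk⟩, h⟩
      obtain rfl : b = b' := by simpa [φ, sub_eq_zero] using hk
      obtain ⟨rfl, rfl⟩ : a = 0 ∧ c = 0 := by simpa [ψ] using h
      exact ⟨b, ⟨hs, hr⟩, rfl⟩
    · rintro ⟨b, ⟨hs, hr⟩, rfl⟩
      exact ⟨⟨⟨hs, hr⟩, by simp [φ, ι]⟩, by simp [ψ, ι]⟩
  have e4 := finrank_submodule_prod S R
  rw [e1] at h1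
  rw [e2, e3, finrank_map_of_injective hι] at h2
  omega

/-- The amount by which the composition of `R` and `S` fails to be geodesic. -/
noncomputable def excess (R S : Submodule K (V × V)) : ℤ :=
  Module.finrank K R + Module.finrank K S - Module.finrank K (comp R S) - Module.finrank K (mid R S)
    - Module.finrank K (fix R) - Module.finrank K (fix S) + Module.finrank K (fix (comp R S))

/-- Both brackets are nonnegative: `fix R` lies in the domain of `R`, `fix S` in the range of `S`,
and a vector fixed by both relations is fixed by their composition. -/
theorem excess_eq (R S : Submodule K (V × V)) : excess R S =
    ((Module.finrank K ↥(R.map (LinearMap.fst K V V) ⊔ S.map (LinearMap.snd K V V)) : ℤ)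
      - Module.finrank K ↥(fix R ⊔ fix S))
    + (Module.finrank K (fix (comp R S)) - Module.finrank K ↥(fix R ⊓ fix S)) := by
  have h1 := finrank_comp_add R S
  have h2 := Submodule.finrank_sup_add_finrank_inf_eq (fix R) (fix S)
  unfold excess
  omega

theorem finrank_fix_sup_fix_le (R S : Submodule K (V × V)) :
    Module.finrank K ↥(fix R ⊔ fix S) ≤
      Module.finrank K ↥(R.map (LinearMap.fst K V V) ⊔ S.map (LinearMap.snd K V V)) :=
  Submodule.finrank_mono (sup_le_sup (fun b hb => ⟨(b, b), hb, rfl⟩) fun b hb => ⟨(b, b), hb, rfl⟩)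

theorem excess_nonneg (R S : Submodule K (V × V)) : 0 ≤ excess R S := by
  have h1 := finrank_fix_sup_fix_le R S
  have h2 := Submodule.finrank_mono (fix_inf_fix_le R S)
  rw [excess_eq]
  omega

/-- Both brackets of `excess_eq` vanish, so the inclusion `fix_inf_fix_le` is between spaces of
equal dimension. This is what makes geodesic factorizations respect juxtapositions. -/
theorem fix_comp_of_excess_eq_zero {R S : Submodule K (V × V)} (h : excess R S = 0) :
    fix (comp R S) = fix R ⊓ fix S := by
  have h1 := finrank_fix_sup_fix_le R S
  have h2 := Submodule.finrank_mono (fix_inf_fix_le R S)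
  rw [excess_eq] at h
  exact (Submodule.eq_of_le_of_finrank_eq (fix_inf_fix_le R S) (by omega)).symm

/-- Both sides compute the dimension of the space `L` of pairs `(b, c)` in `S` with `(0, b)` in `T`
and `(c, 0)` in `R`, by projecting it to `c` and to `b` respectively. -/
theorem finrank_mid_comp (R S T : Submodule K (V × V)) :
    Module.finrank K (mid S T) + Module.finrank K (mid R (comp S T)) =
      Module.finrank K (mid R S) + Module.finrank K (mid (comp R S) T) := by
  let L : Submodule K (V × V) :=
    S ⊓ ((T.comap (LinearMap.inr K V V)).prod (R.comap (LinearMap.inl K V V)))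
  have h1 := finrank_map_add_finrank_inf_ker (LinearMap.fst K V V) L
  have h2 := finrank_map_add_finrank_inf_ker (LinearMap.snd K V V) L
  have e1 : L.map (LinearMap.fst K V V) = mid (comp R S) T := by
    ext b
    constructor
    · rintro ⟨⟨b, c⟩, ⟨h1, h2, h3⟩, rfl⟩
      exact ⟨h2, c, h1, h3⟩
    · rintro ⟨h2, c, h1, h3⟩
      exact ⟨(b, c), ⟨h1, h2, h3⟩, rfl⟩
  have e2 : L.map (LinearMap.snd K V V) = mid R (comp S T) := by
    ext c
    constructor
    · rintro ⟨⟨b, c⟩, ⟨h1, h2, h3⟩, rfl⟩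
      exact ⟨⟨b, h2, h1⟩, h3⟩
    · rintro ⟨⟨b, h2, h1⟩, h3⟩
      exact ⟨(b, c), ⟨h1, h2, h3⟩, rfl⟩
  have e3 : L ⊓ LinearMap.ker (LinearMap.fst K V V) = (mid R S).map (LinearMap.inr K V V) := by
    ext ⟨b, c⟩
    constructor
    · rintro ⟨⟨h1, h2, h3⟩, rfl⟩
      exact ⟨c, ⟨h1, h3⟩, rfl⟩
    · rintro ⟨c, ⟨h1, h3⟩, h⟩
      obtain ⟨rfl, rfl⟩ := Prod.mk.inj h
      exact ⟨⟨h1, T.zero_mem, h3⟩, rfl⟩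
  have e4 : L ⊓ LinearMap.ker (LinearMap.snd K V V) = (mid S T).map (LinearMap.inl K V V) := by
    ext ⟨b, c⟩
    constructor
    · rintro ⟨⟨h1, h2, h3⟩, rfl⟩
      exact ⟨b, ⟨h2, h1⟩, rfl⟩
    · rintro ⟨b, ⟨h2, h1⟩, h⟩
      obtain ⟨rfl, rfl⟩ := Prod.mk.inj h
      exact ⟨⟨h1, h2, R.zero_mem⟩, rfl⟩
  rw [e1, e3, finrank_map_of_injective LinearMap.inr_injective] at h1
  rw [e2, e4, finrank_map_of_injective LinearMap.inl_injective] at h2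
  omega

/-- The dimensions of the intermediate compositions and of their fixed spaces cancel, the triple
compositions agree, and the `mid` terms balance by `finrank_mid_comp`. -/
theorem excess_cocycle (R S T : Submodule K (V × V)) :
    excess S T + excess R (comp S T) = excess R S + excess (comp R S) T := by
  have h := finrank_mid_comp R S T
  have h' := comp_assoc R S T
  unfold excess
  rw [h']
  omega

/-- Two nonnegative integers are both zero exactly when their sum is, and the two sums agree. -/
theorem excess_eq_zero_assoc (R S T : Submodule K (V × V)) :
    (excess S T = 0 ∧ excess R (comp S T) = 0) ↔ (excess R S = 0 ∧ excess (comp R S) T = 0) := by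
  have h := excess_cocycle R S T
  have h1 := excess_nonneg S T
  have h2 := excess_nonneg R (comp S T)
  have h3 := excess_nonneg R S
  have h4 := excess_nonneg (comp R S) T
  omega

end LinRel

/-! ### Functions that are constant on the blocks -/

section Inv

variable {α β : Type*}

/-- The functions that are constant on the blocks of `p`. -/
def Inv (p : Setoid α) : Submodule ℚ (α → ℚ) where
  carrier := {f | p ≤ Setoid.ker f}
  add_mem' := by
    intro f g hf hg x y h
    exact congrArg₂ (· + ·) (hf h) (hg h)
  zero_mem' := fun _ _ _ => rfl
  smul_mem' := by
    intro a f hf x y h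
    exact congrArg (a * ·) (hf h)

theorem mem_Inv_iff_le {p : Setoid α} {f : α → ℚ} : f ∈ Inv p ↔ p ≤ Setoid.ker f := Iff.rfl

theorem mem_Inv {p : Setoid α} {f : α → ℚ} : f ∈ Inv p ↔ ∀ x y, p x y → f x = f y :=
  ⟨fun h _ _ hxy => h hxy, fun h _ _ hxy => h _ _ hxy⟩

open Classical in
theorem exists_mem_Inv_separating {p : Setoid α} {x y : α} (h : ¬ p x y) :
    ∃ f ∈ Inv p, f x = 1 ∧ f y = 0 := by
  refine ⟨fun z => if p x z then 1 else 0, ?_, if_pos (p.refl' x), if_neg h⟩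
  rw [mem_Inv]
  intro u v huv
  have : p x u ↔ p x v := ⟨fun h => p.trans' h huv, fun h => p.trans' h (p.symm' huv)⟩
  simp only [this]

/-- The indicator of a single block separates unrelated points, so a partition can be recovered from
its invariant functions. -/
theorem Inv_le_iff {p q : Setoid α} : Inv p ≤ Inv q ↔ q ≤ p := by
  constructor
  · intro h x y hxy
    by_contra hp
    obtain ⟨f, hf, h1, h0⟩ := exists_mem_Inv_separating hp
    have := (h hf) hxy
    rw [Setoid.ker_def, h1, h0] at this
    exact one_ne_zero this
  · exact fun h f hf => le_trans h hf

theorem Inv_injective : Function.Injective (Inv : Setoid α → _) := fun _ _ h =>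
  le_antisymm (Inv_le_iff.1 h.ge) (Inv_le_iff.1 h.le)

theorem Inv_sup (p q : Setoid α) : Inv (p ⊔ q) = Inv p ⊓ Inv q := by
  ext f
  exact sup_le_iff (a := p) (b := q)

open Classical in
/-- The functions that are constant on the blocks and vanish outside `Q` are the functions on the
set of the blocks that are contained in `Q`. -/
noncomputable def invEquiv (s : Setoid β) (Q : β → Prop) :
    ↥(Inv s ⊓ ⨅ x : {x // ¬ Q x}, LinearMap.ker (LinearMap.proj x.1 : (β → ℚ) →ₗ[ℚ] ℚ)) ≃ₗ[ℚ]
      ({c : Quotient s // ∀ x, Quotient.mk _ x = c → Q x} → ℚ) where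
  toFun F c := Quotient.lift F.1 (mem_Inv.1 F.2.1) c.1
  map_add' F G := by
    ext ⟨c, hc⟩
    induction c using Quotient.inductionOn
    rfl
  map_smul' a F := by
    ext ⟨c, hc⟩
    induction c using Quotient.inductionOn
    rfl
  -- Blocks not contained in `Q` get the value 0, as is forced by the vanishing at their points
  -- outside `Q`.
  invFun g := ⟨fun x => if h : ∀ y, Quotient.mk s y = Quotient.mk s x → Q y
      then g ⟨Quotient.mk s x, h⟩ else 0, by
    constructor
    · refine mem_Inv.2 fun x y hxy => ?_
      have : Quotient.mk s x = Quotient.mk s y := Quotient.sound hxy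
      simp only [this]
    · refine (Submodule.mem_iInf _).2 fun x => ?_
      rw [LinearMap.mem_ker, LinearMap.proj_apply]
      exact dif_neg fun h => x.2 (h _ rfl)⟩
  left_inv F := by
    ext x
    by_cases h : ∀ y, Quotient.mk s y = Quotient.mk s x → Q y
    · exact dif_pos h
    · refine (dif_neg h).trans ?_
      push Not at h
      obtain ⟨y, hy, hQ⟩ := h
      have h0 := (Submodule.mem_iInf _).1 F.2.2 ⟨y, hQ⟩
      exact h0.symm.trans (mem_Inv.1 F.2.1 _ _ (Quotient.exact hy))
  right_inv g := by
    ext ⟨c, hc⟩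
    induction c using Quotient.inductionOn
    exact dif_pos hc

theorem finrank_Inv_inf [Finite β] (s : Setoid β) (Q : β → Prop) : Module.finrank ℚ
    ↥(Inv s ⊓ ⨅ x : {x // ¬ Q x}, LinearMap.ker (LinearMap.proj x.1 : (β → ℚ) →ₗ[ℚ] ℚ)) =
      Nat.card {c : Quotient s // ∀ x, Quotient.mk _ x = c → Q x} := by
  have := Fintype.ofFinite {c : Quotient s // ∀ x, Quotient.mk _ x = c → Q x}
  rw [(invEquiv s Q).finrank_eq, Module.finrank_fintype_fun_eq_card, Nat.card_eq_fintype_card]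

theorem finrank_Inv [Finite β] (s : Setoid β) : Module.finrank ℚ (Inv s) = nc s := by
  have h := finrank_Inv_inf s fun _ => True
  have : IsEmpty {x : β // ¬ True} := ⟨fun x => x.2 trivial⟩
  rw [iInf_of_empty, inf_top_eq] at h
  rw [h, nc]
  exact Nat.card_congr (Equiv.subtypeUnivEquiv fun _ _ _ => trivial)

open Classical in
/-- A function constant on the blocks of a restriction extends. -/
theorem exists_extension {s : Setoid β} {g : α → β} {f : α → ℚ} (hf : f ∈ Inv (s.comap g)) :
    ∃ h ∈ Inv s, h ∘ g = f := by
  -- On a block that meets the image of `g` the value is read off at any preimage, the choice being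
  -- harmless because `f` is invariant; on the other blocks any constant would do.
  refine ⟨fun b => if h : ∃ a, s b (g a) then f h.choose else 0, ?_, ?_⟩
  · rw [mem_Inv]
    intro x y hxy
    have h : (∃ a, s x (g a)) ↔ ∃ a, s y (g a) :=
      ⟨fun ⟨a, h⟩ => ⟨a, s.trans' (s.symm' hxy) h⟩, fun ⟨a, h⟩ => ⟨a, s.trans' hxy h⟩⟩
    by_cases hx : ∃ a, s x (g a)
    · have hy := h.1 hx
      simp only [dif_pos hx, dif_pos hy]
      exact mem_Inv.1 hf _ _
        (s.trans' (s.symm' hx.choose_spec) (s.trans' hxy hy.choose_spec))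
    · simp only [dif_neg hx, dif_neg (mt h.2 hx)]
  · ext a
    have h : ∃ a', s (g a) (g a') := ⟨a, s.refl' _⟩
    simp only [Function.comp_apply, dif_pos h]
    exact mem_Inv.1 hf _ _ (s.symm' h.choose_spec)

/-! ### The geodesic distance -/

/-- The difference of the values at two points. -/
def evalSub (x y : α) : (α → ℚ) →ₗ[ℚ] ℚ :=
  LinearMap.proj (R := ℚ) (φ := fun _ => ℚ) x - LinearMap.proj (R := ℚ) (φ := fun _ => ℚ) y

/-- The partition obtained by gluing the blocks of `x` and `y`. -/
def glue (p : Setoid α) (x y : α) : Setoid α where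
  r u v := p u v ∨ (p u x ∧ p y v) ∨ (p u y ∧ p x v)
  iseqv :=
    { refl := fun u => Or.inl (p.refl' u)
      symm := by
        rintro u v (h | ⟨h1, h2⟩ | ⟨h1, h2⟩)
        · exact Or.inl (p.symm' h)
        · exact Or.inr (Or.inr ⟨p.symm' h2, p.symm' h1⟩)
        · exact Or.inr (Or.inl ⟨p.symm' h2, p.symm' h1⟩)
      trans := by
        have s := fun a b => @Setoid.symm' _ p a b
        have t := fun a b c => @Setoid.trans' _ p a b c
        rintro u v w (h | ⟨h1, h2⟩ | ⟨h1, h2⟩) (h' | ⟨h3, h4⟩ | ⟨h3, h4⟩)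
        · exact Or.inl (t _ _ _ h h')
        · exact Or.inr (Or.inl ⟨t _ _ _ h h3, h4⟩)
        · exact Or.inr (Or.inr ⟨t _ _ _ h h3, h4⟩)
        · exact Or.inr (Or.inl ⟨h1, t _ _ _ h2 h'⟩)
        · exact Or.inr (Or.inl ⟨h1, h4⟩)
        · exact Or.inl (t _ _ _ h1 h4)
        · exact Or.inr (Or.inr ⟨h1, t _ _ _ h2 h'⟩)
        · exact Or.inl (t _ _ _ h1 h4)
        · exact Or.inr (Or.inr ⟨h1, h4⟩) }

theorem glue_glue {p : Setoid α} {x y : α} (h : ¬ p x y) : Glue p (glue p x y) :=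
  ⟨x, y, h, fun _ _ => Iff.rfl⟩

theorem Glue.exists_eq {p q : Setoid α} (h : Glue p q) : ∃ x y, ¬ p x y ∧ q = glue p x y := by
  obtain ⟨x, y, h, h'⟩ := h
  exact ⟨x, y, h, Setoid.ext h'⟩

/-- Gluing imposes the single linear equation `f x = f y`, so its effect on block counts is a
question of codimension at most one. -/
theorem Inv_glue (p : Setoid α) (x y : α) : Inv (glue p x y) = Inv p ⊓
    LinearMap.ker (evalSub x y) := by
  ext f
  rw [Submodule.mem_inf, LinearMap.mem_ker, evalSub, LinearMap.sub_apply, LinearMap.proj_apply,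
    LinearMap.proj_apply, sub_eq_zero]
  constructor
  · intro h
    exact ⟨fun u v huv => h (Or.inl huv), h (Or.inr (Or.inl ⟨p.refl' _, p.refl' _⟩))⟩
  · rintro ⟨h, hxy⟩
    refine mem_Inv.2 ?_
    rw [mem_Inv] at h
    rintro u v (h' | ⟨h1, h2⟩ | ⟨h1, h2⟩)
    · exact h _ _ h'
    · rw [h _ _ h1, ← h _ _ h2, hxy]
    · rw [h _ _ h1, ← h _ _ h2, hxy]

variable [Finite α]

/-- The points `x` and `y` are in different blocks, so the functional is nonzero on `Inv p` and its
kernel there is a hyperplane. -/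
theorem nc_eq_of_glue {p q : Setoid α} (h : Glue p q) : nc p = nc q + 1 := by
  obtain ⟨x, y, hxy, rfl⟩ := h.exists_eq
  have h := LinRel.finrank_map_add_finrank_inf_ker
    (evalSub x y) (Inv p)
  rw [← Inv_glue, finrank_Inv, finrank_Inv] at h
  have h1 : (Inv p).map (evalSub x y) = ⊤ := by
    obtain ⟨f, hf, hx, hy⟩ := exists_mem_Inv_separating hxy
    refine (Ideal.eq_top_iff_one (α := ℚ) _).2 ⟨f, hf, ?_⟩
    simp [evalSub, hx, hy]
  rw [h1, finrank_top, Module.finrank_self] at h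
  omega

/-- The same functional on `Inv (p ⊔ r)` may vanish, so its rank is 0 or 1. -/
theorem nc_sup_le_of_glue {p q : Setoid α} (h : Glue p q) (r : Setoid α) :
    nc (p ⊔ r) ≤ nc (q ⊔ r) + 1 ∧ nc (q ⊔ r) ≤ nc (p ⊔ r) := by
  obtain ⟨x, y, hxy, rfl⟩ := h.exists_eq
  have h := LinRel.finrank_map_add_finrank_inf_ker
    (evalSub x y) (Inv (p ⊔ r))
  rw [Inv_sup, inf_right_comm, ← Inv_glue, ← Inv_sup, ← Inv_sup, finrank_Inv, finrank_Inv] at h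
  have h1 := Submodule.finrank_le
    ((Inv (p ⊔ r)).map (evalSub x y))
  rw [Module.finrank_self] at h1
  omega

/-- The potential `nc p - 2 nc(p ∨ r)` changes by exactly one, up or down, along every edge. -/
theorem le_length_of_walk (r : Setoid α) {p q : Setoid α} (w : (cayleyGraph α).Walk p q) :
    ((nc p : ℤ) - 2 * nc (p ⊔ r)) - (nc q - 2 * nc (q ⊔ r)) ≤ w.length := by
  induction w with
  | nil => simp
  | @cons u v w h _ ih =>
    rw [cayleyGraph, SimpleGraph.fromRel_adj] at h
    rw [SimpleGraph.Walk.length_cons]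
    push_cast
    rcases h.2 with h | h
    · have h1 := nc_eq_of_glue h
      have h2 := nc_sup_le_of_glue h r
      omega
    · have h1 := nc_eq_of_glue h
      have h2 := nc_sup_le_of_glue h r
      omega

/-- As long as `p` is strictly finer than `q`, two blocks of `p` inside one block of `q` can be
glued, which lowers `nc` by one. -/
theorem exists_walk_of_le {p q : Setoid α} (h : p ≤ q) :
    ∃ w : (cayleyGraph α).Walk p q, w.length + nc q = nc p := by
  induction hn : nc p using Nat.strong_induction_on generalizing p with
  | _ n ih =>
  subst hn
  by_cases hqp : q ≤ p
  · obtain rfl := le_antisymm h hqp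
    exact ⟨SimpleGraph.Walk.nil, by simp⟩
  · obtain ⟨x, y, hq, hp⟩ : ∃ x y, q x y ∧ ¬ p x y := by
      by_contra! hh
      exact hqp fun x y => hh x y
    have hg := glue_glue hp
    have hnc := nc_eq_of_glue hg
    have hle : glue p x y ≤ q := by
      rintro u v (h' | ⟨h1, h2⟩ | ⟨h1, h2⟩)
      · exact h h'
      · exact q.trans' (h h1) (q.trans' hq (h h2))
      · exact q.trans' (h h1) (q.trans' (q.symm' hq) (h h2))
    obtain ⟨w, hw⟩ := ih _ (by omega) hle rfl
    have hadj : (cayleyGraph α).Adj p (glue p x y) := by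
      rw [cayleyGraph, SimpleGraph.fromRel_adj]
      refine ⟨fun hh => ?_, Or.inl hg⟩
      rw [← hh] at hnc
      omega
    exact ⟨w.cons hadj, by rw [SimpleGraph.Walk.length_cons]; omega⟩

/-- A shortest path runs through `p ⊔ q`: it first glues up to the join and then splits down to `q`.
-/
theorem dist_add (p q : Setoid α) :
    (cayleyGraph α).dist p q + 2 * nc (p ⊔ q) = nc p + nc q := by
  obtain ⟨w₁, h₁⟩ := exists_walk_of_le (le_sup_left : p ≤ p ⊔ q)
  obtain ⟨w₂, h₂⟩ := exists_walk_of_le (le_sup_right : q ≤ p ⊔ q)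
  have hle := SimpleGraph.dist_le (w₁.append w₂.reverse)
  rw [SimpleGraph.Walk.length_append, SimpleGraph.Walk.length_reverse] at hle
  obtain ⟨w, hw⟩ := (w₁.append w₂.reverse).reachable.exists_walk_length_eq_dist
  -- For `r = q` the potential at the end point is `-nc q`, and the lower bound matches the path
  -- through the join.
  have hge := le_length_of_walk q w
  rw [hw, sup_idem] at hge
  omega

theorem d_eq (p q : Setoid α) : d p q = ((nc p : ℝ) + nc q) / 2 - nc (p ⊔ q) := by
  have h : ((cayleyGraph α).dist p q : ℝ) + 2 * nc (p ⊔ q) = nc p + nc q := by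
    exact_mod_cast dist_add p q
  rw [d]
  linarith

end Inv

/-! ### Partitions as linear relations -/

section toRel

variable {k : ℕ}

/-- The linear relation given by `p`: the pairs `(a, b)` of functions on the upper and the lower
row that together are constant on the blocks. -/
def toRel (p : Pk k) : Submodule ℚ ((Fin k → ℚ) × (Fin k → ℚ)) :=
  (Inv p).comap (LinearEquiv.sumArrowLequivProdArrow (Fin k) (Fin k) ℚ ℚ).symm.toLinearMap

theorem mem_toRel {p : Pk k} {a b : Fin k → ℚ} : (a, b) ∈ toRel p ↔ Sum.elim a b ∈ Inv p := Iff.rfl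

theorem toRel_injective : Function.Injective (toRel : Pk k → _) := by
  intro p q h
  refine Inv_injective (Submodule.ext fun f => ?_)
  have := Submodule.ext_iff.1 h (f ∘ Sum.inl, f ∘ Sum.inr)
  rwa [mem_toRel, mem_toRel, Sum.elim_comp_inl_inr] at this

theorem finrank_toRel (p : Pk k) : Module.finrank ℚ (toRel p) = nc p := by
  rw [← finrank_Inv]
  exact LinearEquiv.finrank_eq (LinearEquiv.ofSubmodule' _ _)

theorem mem_Inv_stack {p q : Pk k} {a b c : Fin k → ℚ} :
    Sum.elim a (Sum.elim b c) ∈ Inv (stack p q) ↔ (a, b) ∈ toRel q ∧ (b, c) ∈ toRel p := by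
  have h : ∀ z : Fin k ⊕ Fin k,
      Sum.elim a (Sum.elim b c) (Sum.map id Sum.inl z) = Sum.elim a b z := by
    rintro (z | z) <;> rfl
  rw [mem_Inv_iff_le, stack_le_iff, mem_toRel, mem_toRel]
  refine and_congr ?_ Iff.rfl
  rw [mem_Inv]
  refine ⟨fun H x y hxy => ?_, fun H x y hxy => ?_⟩
  · rw [← h, ← h]
    exact H hxy
  · rw [Setoid.comap_rel, Setoid.ker_def, h, h]
    exact H x y hxy

/-- The vector in the middle consists of the values on the middle row. It exists because a function
constant on the blocks induced on the outer rows extends to the whole three-row diagram. -/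
theorem toRel_comp (p q : Pk k) : toRel (comp p q) = LinRel.comp (toRel p) (toRel q) := by
  ext ⟨a, c⟩
  rw [LinRel.mem_comp, mem_toRel]
  constructor
  · intro h
    obtain ⟨f, hf, hac⟩ := exists_extension h
    refine ⟨fun j => f (Sum.inr (Sum.inl j)), ?_⟩
    rw [← mem_Inv_stack]
    convert hf using 1
    ext (x | x | x)
    · exact (congrFun hac (Sum.inl x)).symm
    · rfl
    · exact (congrFun hac (Sum.inr x)).symm
  · rintro ⟨b, hb⟩
    rw [← mem_Inv_stack] at hb
    rw [mem_Inv]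
    intro x y hxy
    have := mem_Inv.1 hb _ _ hxy
    rcases x with x | x <;> rcases y with y | y <;> exact this

theorem comp_assoc (p q r : Pk k) : comp (comp p q) r = comp p (comp q r) := by
  apply toRel_injective
  simp only [toRel_comp, LinRel.comp_assoc]

/-- An invariant function on the three rows that vanishes on the outer ones is zero on every
component that touches them and is free on the components inside the middle row. -/
theorem finrank_mid (p q : Pk k) :
    Module.finrank ℚ (LinRel.mid (toRel p) (toRel q)) = kappa p q := by
  rw [kappa, ← finrank_Inv_inf (stack p q) fun x => ∃ j, x = Sum.inr (Sum.inl j)]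
  let ι : (Fin k → ℚ) →ₗ[ℚ] (Fin k ⊕ (Fin k ⊕ Fin k) → ℚ) :=
    { toFun := fun b => Sum.elim 0 (Sum.elim b 0)
      map_add' := by
        intro a b
        ext (x | x | x) <;> simp
      map_smul' := by
        intro a b
        ext (x | x | x) <;> simp }
  have hι : Function.Injective ι := fun a b h =>
    funext fun j => congrFun h (Sum.inr (Sum.inl j))
  rw [← LinRel.finrank_map_of_injective hι]
  refine congrArg (fun S : Submodule ℚ _ => Module.finrank ℚ S) ?_
  ext f
  rw [Submodule.mem_inf, Submodule.mem_iInf]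
  constructor
  · rintro ⟨b, hb, rfl⟩
    refine ⟨mem_Inv_stack.2 hb, ?_⟩
    rintro ⟨x | x | x, hx⟩
    · rfl
    · exact absurd ⟨x, rfl⟩ hx
    · rfl
  · rintro ⟨h1, h2⟩
    have e : ι (fun j => f (Sum.inr (Sum.inl j))) = f := by
      ext (x | x | x)
      · exact (h2 ⟨Sum.inl x, by simp⟩).symm
      · rfl
      · exact (h2 ⟨Sum.inr (Sum.inr x), by simp⟩).symm
    rw [← e] at h1
    exact ⟨_, mem_Inv_stack.1 h1, e⟩

theorem mem_toRel_idPart {a b : Fin k → ℚ} : (a, b) ∈ toRel (idPart k) ↔ a = b := by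
  rw [mem_toRel, mem_Inv]
  constructor
  · intro h
    ext i
    exact h (Sum.inl i) (Sum.inr i) rfl
  · rintro rfl (x | x) (y | y) h <;> exact congrArg a h

/-- Invariance under `id_k` means that both rows carry the same values, so `Inv p ⊓ Inv (idPart k)`
is a diagonal copy of the fixed space. -/
theorem finrank_fix (p : Pk k) :
    Module.finrank ℚ (LinRel.fix (toRel p)) = nc (p ⊔ idPart k) := by
  let ι : (Fin k → ℚ) →ₗ[ℚ] (Fin k ⊕ Fin k → ℚ) :=
    LinearMap.funLeft ℚ ℚ (Sum.elim id id)
  have e : ∀ f, ι f = Sum.elim f f := by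
    intro f
    ext (x | x) <;> rfl
  have hι : Function.Injective ι := LinearMap.funLeft_injective_of_surjective _ _ _
    fun x => ⟨Sum.inl x, rfl⟩
  rw [← finrank_Inv, ← LinRel.finrank_map_of_injective hι, Inv_sup]
  refine congrArg (fun S : Submodule ℚ _ => Module.finrank ℚ S) ?_
  ext f
  constructor
  · rintro ⟨a, ha, rfl⟩
    rw [e]
    exact ⟨ha, mem_toRel_idPart.2 rfl⟩
  · rintro ⟨h1, h2⟩
    have hf := Sum.elim_comp_inl_inr f
    rw [← hf] at h2
    rw [← mem_toRel_idPart.1 (mem_toRel.2 h2)] at hf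
    refine ⟨f ∘ Sum.inl, ?_, (e _).trans hf⟩
    change Sum.elim (f ∘ Sum.inl) (f ∘ Sum.inl) ∈ Inv p
    rwa [hf]

theorem fix_idPart : LinRel.fix (toRel (idPart k)) = ⊤ :=
  eq_top_iff.2 fun _ _ => mem_toRel_idPart.2 rfl

theorem nc_idPart : nc (idPart k) = k := by
  have h := finrank_fix (idPart k)
  rw [sup_idem, fix_idPart, finrank_top] at h
  simpa using h.symm

/-- The excess of a pair of partitions. -/
noncomputable def excess (p q : Pk k) : ℤ := LinRel.excess (toRel p) (toRel q)

theorem excess_eq (p q : Pk k) : excess p q = nc p + nc q - nc (comp p q) - kappa p q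
    - nc (p ⊔ idPart k) - nc (q ⊔ idPart k) + nc (comp p q ⊔ idPart k) := by
  rw [excess, LinRel.excess, ← toRel_comp, finrank_mid]
  simp only [finrank_toRel, finrank_fix]

/-- After substitution of `d_eq` the halves combine and the geodesic equation becomes an equation
between integers. -/
theorem mem_kreweras_iff {p p' p'' : Pk k} :
    p'' ∈ kreweras p p' ↔ p = comp p' p'' ∧ excess p' p'' = 0 := by
  rw [kreweras, Set.mem_ofPred_eq]
  refine and_congr_right ?_
  rintro rfl
  rw [excess_eq]
  simp only [d_eq, nc_idPart, sup_comm (idPart k)]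
  rw [← @Int.cast_eq_zero ℝ]
  push_cast
  constructor <;> intro h <;> linarith

theorem idPart_comp (p : Pk k) : comp (idPart k) p = p := by
  rw [idPart, ofPerm_comp]
  ext x y
  rcases x with x | x <;> rcases y with y | y <;> rfl

theorem comp_idPart (p : Pk k) : comp p (idPart k) = p := by
  rw [idPart, comp_ofPerm]
  ext x y
  rcases x with x | x <;> rcases y with y | y <;> rfl

theorem kappa_idPart_left (p : Pk k) : kappa (idPart k) p = 0 := by
  have h : LinRel.mid (toRel (idPart k)) (toRel p) = ⊥ :=
    eq_bot_iff.2 fun b hb => mem_toRel_idPart.1 hb.2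
  rw [← finrank_mid, h, finrank_bot]

theorem kappa_idPart_right (p : Pk k) : kappa p (idPart k) = 0 := by
  have h : LinRel.mid (toRel p) (toRel (idPart k)) = ⊥ :=
    eq_bot_iff.2 fun b hb => (mem_toRel_idPart.1 hb.1).symm
  rw [← finrank_mid, h, finrank_bot]

theorem excess_idPart_left (p : Pk k) : excess (idPart k) p = 0 := by
  rw [excess_eq, idPart_comp, kappa_idPart_left, sup_idem]
  ring

theorem excess_idPart_right (p : Pk k) : excess p (idPart k) = 0 := by
  rw [excess_eq, comp_idPart, kappa_idPart_right, sup_idem]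
  ring

end toRel

/-! ### The coalgebra `(A, Δ_⊠, ε_⊠)` -/

theorem linearMap_ext {V : Type*} [AddCommMonoid V] [Module ℂ V] {f g : PAlg →ₗ[ℂ] V}
    (h : ∀ (k : ℕ) (p : Pk k), f (vec (mk p)) = g (vec (mk p))) : f = g := by
  refine (MonoidAlgebra.basis Orb ℂ).ext fun x => ?_
  obtain ⟨k, p, rfl⟩ := mk_surjective x
  rw [MonoidAlgebra.basis_apply]
  exact h k p

open Classical in
/-- The geodesic factorizations of `p`. -/
noncomputable def factorizations {k : ℕ} (p : Pk k) : Finset (Pk k × Pk k) :=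
  Finset.univ.filter fun c => comp c.1 c.2 = p ∧ excess c.1 c.2 = 0

theorem mem_factorizations {k : ℕ} {p : Pk k} {c : Pk k × Pk k} :
    c ∈ factorizations p ↔ comp c.1 c.2 = p ∧ excess c.1 c.2 = 0 := by
  simp [factorizations]

theorem deltaTimes_vec {k : ℕ} (p : Pk k) : deltaTimes (vec (mk p)) =
    ∑ c ∈ factorizations p, vec (mk c.1) ⊗ₜ[ℂ] vec (mk c.2) := by
  classical
  rw [deltaTimes_vec_mk]
  refine Finset.sum_congr (Finset.ext fun c => ?_) fun _ _ => rfl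
  rw [Finset.mem_filter, mem_factorizations, mem_kreweras_iff]
  constructor
  · rintro ⟨-, h, -, h'⟩
    exact ⟨h, h'⟩
  · rintro ⟨h, h'⟩
    exact ⟨Finset.mem_univ _, h, h.symm, h'⟩

theorem excess_assoc {k : ℕ} (p q r : Pk k) :
    (excess q r = 0 ∧ excess p (comp q r) = 0) ↔
      (excess p q = 0 ∧ excess (comp p q) r = 0) := by
  simp only [excess, toRel_comp]
  exact LinRel.excess_eq_zero_assoc _ _ _

/-- Both sides are sums over triples with composition `p`, with the zero-excess conditions for the
two bracketings. These conditions agree by `excess_assoc`, so regrouping the triple is a bijection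
of the index sets. -/
theorem deltaTimes_coassoc : TensorProduct.assoc ℂ PAlg PAlg PAlg ∘ₗ deltaTimes.rTensor PAlg ∘ₗ
    deltaTimes = deltaTimes.lTensor PAlg ∘ₗ deltaTimes := by
  refine linearMap_ext fun k p => ?_
  simp only [LinearMap.comp_apply, LinearEquiv.coe_coe, deltaTimes_vec, map_sum,
    LinearMap.rTensor_tmul, LinearMap.lTensor_tmul, TensorProduct.sum_tmul, TensorProduct.tmul_sum,
    TensorProduct.assoc_tmul]
  rw [Finset.sum_sigma', Finset.sum_sigma']
  refine Finset.sum_bij' (fun x _ => ⟨(x.2.1, comp x.2.2 x.1.2), (x.2.2, x.1.2)⟩)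
    (fun x _ => ⟨(comp x.1.1 x.2.1, x.2.2), (x.1.1, x.2.1)⟩) ?_ ?_ ?_ ?_ ?_
  · rintro ⟨⟨a, c⟩, ⟨a', b⟩⟩ h
    simp only [Finset.mem_sigma, mem_factorizations] at h ⊢
    obtain ⟨⟨rfl, h1⟩, rfl, h2⟩ := h
    obtain ⟨h3, h4⟩ := (excess_assoc a' b c).2 ⟨h2, h1⟩
    exact ⟨⟨(comp_assoc _ _ _).symm, h4⟩, trivial, h3⟩
  · rintro ⟨⟨a, c⟩, ⟨a', b⟩⟩ h
    simp only [Finset.mem_sigma, mem_factorizations] at h ⊢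
    obtain ⟨⟨rfl, h1⟩, rfl, h2⟩ := h
    obtain ⟨h3, h4⟩ := (excess_assoc a a' b).1 ⟨h2, h1⟩
    exact ⟨⟨comp_assoc _ _ _, h4⟩, trivial, h3⟩
  · rintro ⟨⟨a, c⟩, ⟨a', b⟩⟩ h
    simp only [Finset.mem_sigma, mem_factorizations] at h
    obtain ⟨⟨-, -⟩, rfl, -⟩ := h
    rfl
  · rintro ⟨⟨a, c⟩, ⟨a', b⟩⟩ h
    simp only [Finset.mem_sigma, mem_factorizations] at h
    obtain ⟨⟨-, -⟩, rfl, -⟩ := h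
    rfl
  · rintro ⟨⟨a, c⟩, ⟨a', b⟩⟩ -
    rfl

theorem mk_eq_mk_idPart_iff {k l : ℕ} {p : Pk k} : mk p = mk (idPart l) ↔ k = l ∧ p = idPart k := by
  constructor
  · intro h
    obtain rfl : k = l := congrArg dg h
    obtain ⟨e, he⟩ := mk_eq_iff.1 h.symm
    exact ⟨rfl, by rw [he, idPart_relabel]⟩
  · rintro ⟨rfl, rfl⟩
    rfl

open Classical in
theorem counitTimes_vec {k : ℕ} (p : Pk k) :
    counitTimes (vec (mk p)) = if p = idPart k then 1 else 0 := by
  rw [counitTimes, linExt_vec]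
  refine if_congr ⟨?_, ?_⟩ rfl rfl
  · rintro ⟨l, h⟩
    exact (mk_eq_mk_idPart_iff.1 h).2
  · rintro rfl
    exact ⟨k, rfl⟩

/-- The counit kills every term whose first factor is not `id_k`; the second factor is then `p`, and
the pair `(id_k, p)` does occur since its excess is zero. -/
theorem deltaTimes_counit_left :
    counitTimes.rTensor PAlg ∘ₗ deltaTimes = TensorProduct.mk ℂ _ _ 1 := by
  classical
  refine linearMap_ext fun k p => ?_
  simp only [LinearMap.comp_apply, deltaTimes_vec, map_sum, LinearMap.rTensor_tmul,
    counitTimes_vec, TensorProduct.mk_apply]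
  have hp : (idPart k, p) ∈ factorizations p :=
    (mem_factorizations (c := (idPart k, p))).2 ⟨idPart_comp p, excess_idPart_left p⟩
  rw [Finset.sum_eq_single_of_mem _ hp]
  · rw [if_pos rfl]
  · rintro ⟨a, b⟩ h hne
    rw [mem_factorizations] at h
    rw [if_neg, TensorProduct.zero_tmul]
    rintro rfl
    exact hne (by rw [← h.1, idPart_comp])

theorem deltaTimes_counit_right :
    counitTimes.lTensor PAlg ∘ₗ deltaTimes = (TensorProduct.mk ℂ _ _).flip 1 := by
  classical
  refine linearMap_ext fun k p => ?_
  simp only [LinearMap.comp_apply, deltaTimes_vec, map_sum, LinearMap.lTensor_tmul,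
    counitTimes_vec, LinearMap.flip_apply, TensorProduct.mk_apply]
  have hp : (p, idPart k) ∈ factorizations p :=
    (mem_factorizations (c := (p, idPart k))).2 ⟨comp_idPart p, excess_idPart_right p⟩
  rw [Finset.sum_eq_single_of_mem _ hp]
  · rw [if_pos rfl]
  · rintro ⟨a, b⟩ h hne
    rw [mem_factorizations] at h
    rw [if_neg, TensorProduct.tmul_zero]
    rintro rfl
    exact hne (by rw [← h.1, comp_idPart])

/-! ### Multiplicativity of `Δ_⊠` and `ε_⊠` -/

section Multiplicative

variable {B : Type*} [Semiring B] [Algebra ℂ B]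

theorem one_eq_vec : (1 : PAlg) = vec (mk (idPart 0)) := rfl

theorem vec_mul_vec (x y : Orb) : vec x * vec y = vec (x * y) :=
  (map_mul (MonoidAlgebra.of ℂ Orb) x y).symm

theorem mk_mul_mk {k l : ℕ} (p : Pk k) (q : Pk l) : mk p * mk q = mk (tensor p q) := rfl

/-- Both sides are bilinear, so multiplicativity need only be tested on basis vectors. -/
theorem linearMap_mul {g : PAlg →ₗ[ℂ] B} (h : ∀ (k : ℕ) (p : Pk k) (l : ℕ) (q : Pk l),
    g (vec (mk (tensor p q))) = g (vec (mk p)) * g (vec (mk q))) (a b : PAlg) :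
    g (a * b) = g a * g b := by
  suffices H : (LinearMap.mul ℂ PAlg).compr₂ g = (LinearMap.mul ℂ B).compl₁₂ g g from
    congrArg (fun g : PAlg →ₗ[ℂ] PAlg →ₗ[ℂ] B => g a b) H
  refine linearMap_ext fun k p => linearMap_ext fun l q => ?_
  change g (vec (mk p) * vec (mk q)) = g (vec (mk p)) * g (vec (mk q))
  rw [vec_mul_vec, mk_mul_mk, h]

end Multiplicative

/-! ### Juxtaposition in terms of linear relations, and geodesic factorizations of a juxtaposition.
-/

section Tensor

variable {k l : ℕ}

theorem mem_toRel_tensor {p : Pk k} {q : Pk l} {a b : Fin (k + l) → ℚ} :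
    (a, b) ∈ toRel (tensor p q) ↔
      (a ∘ Fin.castAdd l, b ∘ Fin.castAdd l) ∈ toRel p ∧
        (a ∘ Fin.natAdd k, b ∘ Fin.natAdd k) ∈ toRel q := by
  have hL : ∀ x, Sum.elim a b (inL k l x) =
      Sum.elim (a ∘ Fin.castAdd l) (b ∘ Fin.castAdd l) x := by
    rintro (x | x) <;> rfl
  have hR : ∀ x, Sum.elim a b (inR k l x) =
      Sum.elim (a ∘ Fin.natAdd k) (b ∘ Fin.natAdd k) x := by
    rintro (x | x) <;> rfl
  simp only [mem_toRel, mem_Inv, ← hL, ← hR]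
  constructor
  · exact fun h => ⟨fun x y hxy => h _ _ ((tensor_inL_inL p q x y).2 hxy),
      fun x y hxy => h _ _ ((tensor_inR_inR p q x y).2 hxy)⟩
  · rintro ⟨h1, h2⟩ _ _ (⟨x, y, h, rfl, rfl⟩ | ⟨x, y, h, rfl, rfl⟩)
    · exact h1 _ _ h
    · exact h2 _ _ h

theorem append_comp_castAdd (a : Fin k → ℚ) (b : Fin l → ℚ) :
    Fin.append a b ∘ Fin.castAdd l = a :=
  funext fun i => Fin.append_left a b i

theorem append_comp_natAdd (a : Fin k → ℚ) (b : Fin l → ℚ) :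
    Fin.append a b ∘ Fin.natAdd k = b :=
  funext fun i => Fin.append_right a b i

/-- The relation of a juxtaposition is a product of relations, and a middle vector for it is the
concatenation of two middle vectors. -/
theorem comp_tensor (p p' : Pk k) (q q' : Pk l) :
    comp (tensor p q) (tensor p' q') = tensor (comp p p') (comp q q') := by
  apply toRel_injective
  ext ⟨a, c⟩
  simp only [toRel_comp, mem_toRel_tensor, LinRel.mem_comp]
  constructor
  · rintro ⟨b, ⟨h1, h2⟩, h3, h4⟩
    exact ⟨⟨_, h1, h3⟩, _, h2, h4⟩
  · rintro ⟨⟨b, h1, h3⟩, b', h2, h4⟩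
    refine ⟨Fin.append b b', ?_⟩
    rw [append_comp_castAdd, append_comp_natAdd]
    exact ⟨⟨h1, h2⟩, h3, h4⟩

/-- Functions on a juxtaposition of two rows. -/
def splitEquiv (k l : ℕ) : (Fin (k + l) → ℚ) ≃ₗ[ℚ] (Fin k → ℚ) × (Fin l → ℚ) where
  toFun a := (a ∘ Fin.castAdd l, a ∘ Fin.natAdd k)
  map_add' _ _ := rfl
  map_smul' _ _ := rfl
  invFun x := Fin.append x.1 x.2
  left_inv a := by
    ext i
    refine Fin.addCases (fun i => ?_) (fun i => ?_) i <;> simp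
  right_inv x := Prod.ext (append_comp_castAdd _ _) (append_comp_natAdd _ _)

theorem finrank_comap_splitEquiv (S : Submodule ℚ (Fin k → ℚ)) (T : Submodule ℚ (Fin l → ℚ)) :
    Module.finrank ℚ ((S.prod T).comap (splitEquiv k l).toLinearMap) =
      Module.finrank ℚ S + Module.finrank ℚ T := by
  rw [← LinRel.finrank_submodule_prod]
  exact LinearEquiv.finrank_eq (LinearEquiv.ofSubmodule' _ _)

theorem nc_tensor_sup_idPart (p : Pk k) (q : Pk l) :
    nc (tensor p q ⊔ idPart (k + l)) = nc (p ⊔ idPart k) + nc (q ⊔ idPart l) := by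
  simp only [← finrank_fix]
  rw [← finrank_comap_splitEquiv]
  refine congrArg (fun S : Submodule ℚ _ => Module.finrank ℚ S) ?_
  ext a
  exact mem_toRel_tensor

theorem kappa_tensor (p p' : Pk k) (q q' : Pk l) :
    kappa (tensor p q) (tensor p' q') = kappa p p' + kappa q q' := by
  simp only [← finrank_mid]
  rw [← finrank_comap_splitEquiv]
  refine congrArg (fun S : Submodule ℚ _ => Module.finrank ℚ S) ?_
  ext a
  rw [LinRel.mem_mid, mem_toRel_tensor, mem_toRel_tensor]
  exact and_and_and_comm

theorem nc_tensor (p : Pk k) (q : Pk l) : nc (tensor p q) = nc p + nc q := by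
  simp only [← finrank_toRel]
  rw [← LinRel.finrank_submodule_prod]
  let e := ((splitEquiv k l).prodCongr (splitEquiv k l)).trans
    (LinearEquiv.prodProdProdComm ℚ (Fin k → ℚ) (Fin l → ℚ) (Fin k → ℚ) (Fin l → ℚ))
  have h : toRel (tensor p q) = ((toRel p).prod (toRel q)).comap e.toLinearMap := by
    ext ⟨a, b⟩
    exact mem_toRel_tensor
  rw [h]
  exact LinearEquiv.finrank_eq (LinearEquiv.ofSubmodule' _ _)

theorem excess_tensor (p p' : Pk k) (q q' : Pk l) :
    excess (tensor p q) (tensor p' q') = excess p p' + excess q q' := by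
  simp only [excess_eq, comp_tensor, nc_tensor, kappa_tensor, nc_tensor_sup_idPart]
  push_cast
  ring

theorem tensor_injective {p p' : Pk k} {q q' : Pk l} (h : tensor p q = tensor p' q') :
    p = p' ∧ q = q' := by
  constructor
  · ext x y
    rw [← tensor_inL_inL p q, h, tensor_inL_inL]
  · ext x y
    rw [← tensor_inR_inR p q, h, tensor_inR_inR]

/-- The indicator function of the left columns in a juxtaposition. -/
def leftIndicator (k l : ℕ) : Fin (k + l) → ℚ := Fin.append (fun _ => 1) fun _ => 0

/-- The vector is constant on either side of the cut, and no block of a juxtaposition crosses the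
cut. -/
theorem leftIndicator_mem_fix_tensor (p : Pk k) (q : Pk l) :
    leftIndicator k l ∈ LinRel.fix (toRel (tensor p q)) := by
  have hc : ∀ {m : ℕ} (r : Pk m) (c : ℚ), ((fun _ => c), (fun _ => c)) ∈ toRel r := by
    intro m r c
    rw [mem_toRel, mem_Inv]
    rintro (x | x) (y | y) _ <;> rfl
  rw [LinRel.mem_fix, mem_toRel_tensor, leftIndicator, append_comp_castAdd, append_comp_natAdd]
  exact ⟨hc _ _, hc _ _⟩

/-- A fixed vector with the value 1 on the left and 0 on the right forbids blocks across the cut, so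
`r` is the juxtaposition of its two restrictions. -/
theorem exists_eq_tensor {r : Pk (k + l)} (h : leftIndicator k l ∈ LinRel.fix (toRel r)) :
    ∃ (p : Pk k) (q : Pk l), r = tensor p q := by
  have h' := mem_Inv.1 (mem_toRel.1 (LinRel.mem_fix.1 h))
  have hL : ∀ x, Sum.elim (leftIndicator k l) (leftIndicator k l) (inL k l x) = 1 := by
    rintro (x | x) <;> simp [leftIndicator, inL]
  have hR : ∀ x, Sum.elim (leftIndicator k l) (leftIndicator k l) (inR k l x) = 0 := by
    rintro (x | x) <;> simp [leftIndicator, inR]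
  have hLR : ∀ x y, ¬ r (inL k l x) (inR k l y) := by
    intro x y hxy
    have := h' _ _ hxy
    rw [hL, hR] at this
    exact one_ne_zero this
  refine ⟨r.comap (inL k l), r.comap (inR k l), ?_⟩
  ext x y
  rcases inL_or_inR x with ⟨x, rfl⟩ | ⟨x, rfl⟩ <;> rcases inL_or_inR y with ⟨y, rfl⟩ | ⟨y, rfl⟩
  · exact (tensor_inL_inL (r.comap (inL k l)) (r.comap (inR k l)) x y).symm
  · exact iff_of_false (hLR x y) (not_tensor_inL_inR _ _ _ _)
  · exact iff_of_false (fun h => hLR y x (r.symm' h)) (not_tensor_inR_inL _ _ _ _)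
  · exact (tensor_inR_inR (r.comap (inL k l)) (r.comap (inR k l)) x y).symm

theorem excess_nonneg (p q : Pk k) : 0 ≤ excess p q := LinRel.excess_nonneg _ _

/-- The substance is surjectivity: every geodesic factorization of a juxtaposition is a
juxtaposition of geodesic factorizations. -/
theorem sum_factorizations_tensor {M : Type*} [AddCommMonoid M] (p : Pk k) (q : Pk l)
    (f : Pk (k + l) → Pk (k + l) → M) : ∑ c ∈ factorizations (tensor p q), f c.1 c.2 =
      ∑ c ∈ factorizations p, ∑ c' ∈ factorizations q, f (tensor c.1 c'.1) (tensor c.2 c'.2) := by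
  rw [← Finset.sum_product']
  symm
  refine Finset.sum_bij (fun x _ => (tensor x.1.1 x.2.1, tensor x.1.2 x.2.2)) ?_ ?_ ?_ ?_
  · rintro ⟨⟨a, b⟩, ⟨a', b'⟩⟩ h
    simp only [Finset.mem_product, mem_factorizations] at h ⊢
    rw [comp_tensor, excess_tensor, h.1.1, h.2.1, h.1.2, h.2.2]
    exact ⟨rfl, rfl⟩
  · rintro ⟨⟨a, b⟩, ⟨a', b'⟩⟩ - ⟨⟨c, d⟩, ⟨c', d'⟩⟩ - h
    obtain ⟨rfl, rfl⟩ := tensor_injective (Prod.mk.inj h).1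
    obtain ⟨rfl, rfl⟩ := tensor_injective (Prod.mk.inj h).2
    rfl
  · rintro ⟨r, s⟩ h
    simp only [mem_factorizations] at h
    have hf := leftIndicator_mem_fix_tensor p q
    -- Zero excess turns the fixed space of the composition into an intersection, so the indicator
    -- of the cut is fixed by `r` and by `s` separately.
    rw [← h.1, toRel_comp, LinRel.fix_comp_of_excess_eq_zero h.2] at hf
    obtain ⟨a, a', rfl⟩ := exists_eq_tensor hf.1
    obtain ⟨b, b', rfl⟩ := exists_eq_tensor hf.2
    rw [comp_tensor, excess_tensor] at h
    obtain ⟨rfl, rfl⟩ := tensor_injective h.1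
    -- The two excesses are nonnegative and add up to zero, so each of them is zero.
    have h1 := excess_nonneg a b
    have h2 := excess_nonneg a' b'
    refine ⟨((a, b), (a', b')), ?_, rfl⟩
    simp only [Finset.mem_product, mem_factorizations]
    exact ⟨⟨trivial, by omega⟩, trivial, by omega⟩
  · rintro ⟨⟨a, b⟩, ⟨a', b'⟩⟩ -
    rfl

theorem tensor_eq_idPart_iff {p : Pk k} {q : Pk l} :
    tensor p q = idPart (k + l) ↔ p = idPart k ∧ q = idPart l := by
  have h : tensor (idPart k) (idPart l) = idPart (k + l) := by
    apply toRel_injective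
    ext ⟨a, b⟩
    rw [mem_toRel_tensor, mem_toRel_idPart, mem_toRel_idPart, mem_toRel_idPart,
      ← (splitEquiv k l).injective.eq_iff]
    exact Prod.mk_inj.symm
  rw [← h]
  exact ⟨tensor_injective, by rintro ⟨rfl, rfl⟩; rfl⟩

instance : Subsingleton (Pk 0) :=
  ⟨fun _ _ => Setoid.ext fun x => (x.elim Fin.elim0 Fin.elim0 : _)⟩

end Tensor

/-! ### The bialgebra given by `Δ_⊠`. -/

theorem isBialgebra_deltaTimes : IsBialgebra deltaTimes counitTimes where
  coassoc := deltaTimes_coassoc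
  counit_left := deltaTimes_counit_left
  counit_right := deltaTimes_counit_right
  counit_one := by
    classical
    rw [one_eq_vec, counitTimes_vec, if_pos rfl]
  counit_mul := by
    classical
    refine linearMap_mul fun k p l q => ?_
    simp only [counitTimes_vec, tensor_eq_idPart_iff, ite_and]
    split_ifs <;> simp
  comul_one := by
    have h : factorizations (idPart 0) = {(idPart 0, idPart 0)} := by
      ext c
      rw [mem_factorizations, Finset.mem_singleton]
      refine iff_of_true ⟨Subsingleton.elim _ _, ?_⟩ (Subsingleton.elim _ _)
      rw [Subsingleton.elim c.1 (idPart 0), excess_idPart_left]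
    rw [one_eq_vec, deltaTimes_vec, h, Finset.sum_singleton]
    rfl
  comul_mul := by
    refine linearMap_mul fun k p l q => ?_
    rw [deltaTimes_vec, deltaTimes_vec, deltaTimes_vec,
      sum_factorizations_tensor p q fun a b => vec (mk a) ⊗ₜ[ℂ] vec (mk b), Finset.sum_mul_sum]
    simp only [Algebra.TensorProduct.tmul_mul_tmul, vec_mul_vec, mk_mul_mk]

/-! ### Multiplicativity of `Δ_⊞` -/

section Cycles

variable {k l : ℕ}

theorem fix_toRel_eq (p : Pk k) {a : Fin k → ℚ} :
    a ∈ LinRel.fix (toRel p) ↔ Sum.elim a a ∈ Inv (p ⊔ idPart k) := by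
  rw [Inv_sup, Submodule.mem_inf, LinRel.mem_fix, ← mem_toRel, ← mem_toRel, mem_toRel_idPart]
  exact (and_iff_left rfl).symm

/-- The indicator function of a set of columns. -/
def indicator (J : Finset (Fin k)) : Fin k → ℚ := fun i => if i ∈ J then 1 else 0

theorem indicator_eq_iff {J : Finset (Fin k)} {i j : Fin k} :
    indicator J i = indicator J j ↔ (i ∈ J ↔ j ∈ J) := by
  unfold indicator
  split_ifs with h1 h2 h2 <;> simp [h1, h2]

theorem sup_idPart_inr (p : Pk k) (i : Fin k) :
    (p ⊔ idPart k) (Sum.inr i) (Sum.inl i) :=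
  (le_sup_right : idPart k ≤ p ⊔ idPart k) rfl

/-- Unions of cycles become 0-1 vectors related to themselves, so that `mem_toRel_tensor` applies to
them. -/
theorem isUnionOfCycles_iff {p : Pk k} {J : Finset (Fin k)} :
    IsUnionOfCycles p J ↔ indicator J ∈ LinRel.fix (toRel p) := by
  rw [fix_toRel_eq, mem_Inv]
  constructor
  · intro h
    -- Through `id_k` every point is joined to the upper point of its column, so testing the upper
    -- row suffices.
    have key : ∀ x, (p ⊔ idPart k) x (Sum.inl (Sum.elim id id x)) := by
      rintro (x | x)
      · exact Setoid.refl' _ _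
      · exact sup_idPart_inr p x
    intro x y hxy
    have := indicator_eq_iff.2 (h _ _ (Setoid.trans' _ (Setoid.symm' _ (key x))
      (Setoid.trans' _ hxy (key y))))
    rcases x with x | x <;> rcases y with y | y <;> exact this
  · intro h i j hij
    exact indicator_eq_iff.1 (h _ _ hij)

theorem IsUnionOfCycles.mem_iff {p : Pk k} {J : Finset (Fin k)} (h : IsUnionOfCycles p J)
    {x y : Fin k ⊕ Fin k} (hxy : p x y) : Sum.elim id id x ∈ J ↔ Sum.elim id id y ∈ J := by
  have := mem_Inv.1 (isUnionOfCycles_iff.1 h) x y hxy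
  rw [← indicator_eq_iff]
  rcases x with x | x <;> rcases y with y | y <;> exact this

/-- The increasing enumeration of `J` used by `extract` can be replaced by any other one, since the
change of enumeration is a relabelling of the columns. -/
theorem mk_extract_eq {m : ℕ} {r : Pk m} {p : Pk k} {J : Finset (Fin k)} (g : Fin m → Fin k)
    (hg : Function.Injective g) (hJ : ∀ i, i ∈ J ↔ ∃ j, g j = i)
    (h : ∀ x y, r x y ↔ p (Sum.map g g x) (Sum.map g g y)) : mk (extract p J) = mk r := by
  let e₁ : Fin m ≃ J := Equiv.ofBijective (fun i => ⟨g i, (hJ _).2 ⟨i, rfl⟩⟩) <| by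
    refine ⟨fun i j hij => hg (congrArg Subtype.val hij), ?_⟩
    rintro ⟨i, hi⟩
    obtain ⟨j, rfl⟩ := (hJ _).1 hi
    exact ⟨j, rfl⟩
  let e : Fin m ≃ Fin J.card := e₁.trans (J.orderIsoOfFin rfl).symm.toEquiv
  have he : ∀ i, J.orderEmbOfFin rfl (e i) = g i := by
    intro i
    rw [← Finset.coe_orderIsoOfFin_apply]
    simp only [e, Equiv.trans_apply]
    exact congrArg Subtype.val ((J.orderIsoOfFin rfl).apply_symm_apply (e₁ i))
  refine (mk_eq_of_rel e fun x y => ?_).symm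
  rw [h]
  change _ ↔ p (Sum.map (J.orderEmbOfFin rfl) (J.orderEmbOfFin rfl) (Sum.map e e x))
    (Sum.map (J.orderEmbOfFin rfl) (J.orderEmbOfFin rfl) (Sum.map e e y))
  rcases x with x | x <;> rcases y with y | y <;> simp only [Sum.map_inl, Sum.map_inr, he]

theorem mk_extract_univ (p : Pk k) : mk (extract p Finset.univ) = mk p :=
  mk_extract_eq id Function.injective_id (by simp) (by simp)

theorem mk_extract_empty (p : Pk k) : mk (extract p ∅) = 1 :=
  mk_extract_eq (r := idPart 0) Fin.elim0 (fun i => i.elim0) (by simp)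
    fun x => (x.elim Fin.elim0 Fin.elim0 : _)

theorem orderEmbOfFin_rel {p : Pk k} {J : Finset (Fin k)} (x y : Fin J.card ⊕ Fin J.card) :
    extract p J x y ↔ p (Sum.map (J.orderEmbOfFin rfl) (J.orderEmbOfFin rfl) x)
      (Sum.map (J.orderEmbOfFin rfl) (J.orderEmbOfFin rfl) y) := Iff.rfl

/-- The extraction to a disjoint union of columns without links between them. -/
theorem mk_extract_eq_mul {m n : ℕ} {r : Pk m} {s : Pk n} {p : Pk k} {J : Finset (Fin k)}
    (f : Fin m → Fin k) (g : Fin n → Fin k) (hf : Function.Injective f)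
    (hg : Function.Injective g) (hfg : ∀ i j, f i ≠ g j)
    (hJ : ∀ i, i ∈ J ↔ (∃ j, f j = i) ∨ ∃ j, g j = i)
    (hr : ∀ x y, r x y ↔ p (Sum.map f f x) (Sum.map f f y))
    (hs : ∀ x y, s x y ↔ p (Sum.map g g x) (Sum.map g g y))
    (hrs : ∀ x y, ¬ p (Sum.map f f x) (Sum.map g g y)) : mk (extract p J) = mk r * mk s := by
  rw [mk_mul_mk]
  let h : Fin (m + n) → Fin k := Fin.append f g
  have hL : ∀ x, Sum.map h h (inL m n x) = Sum.map f f x := by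
    rintro (x | x) <;> simp [h, inL]
  have hR : ∀ x, Sum.map h h (inR m n x) = Sum.map g g x := by
    rintro (x | x) <;> simp [h, inR]
  refine mk_extract_eq h ?_ ?_ ?_
  · exact Fin.append_injective_iff.2 ⟨hf, hg, hfg⟩
  · intro i
    rw [hJ]
    constructor
    · rintro (⟨j, rfl⟩ | ⟨j, rfl⟩)
      · exact ⟨Fin.castAdd n j, Fin.append_left _ _ _⟩
      · exact ⟨Fin.natAdd m j, Fin.append_right _ _ _⟩
    · rintro ⟨j, rfl⟩
      refine Fin.addCases (fun j => ?_) (fun j => ?_) j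
      · exact Or.inl ⟨j, (Fin.append_left _ _ _).symm⟩
      · exact Or.inr ⟨j, (Fin.append_right _ _ _).symm⟩
  · intro x y
    rcases inL_or_inR x with ⟨x, rfl⟩ | ⟨x, rfl⟩ <;>
      rcases inL_or_inR y with ⟨y, rfl⟩ | ⟨y, rfl⟩
    · rw [hL, hL, tensor_inL_inL, hr]
    · rw [hL, hR]
      exact iff_of_false (not_tensor_inL_inR _ _ _ _) (hrs _ _)
    · rw [hL, hR]
      exact iff_of_false (not_tensor_inR_inL _ _ _ _) fun h => hrs _ _ (p.symm' h)
    · rw [hR, hR, tensor_inR_inR, hs]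

/-- No block of `p` joins a column of `J` to a column outside, so after sorting the columns `p` is a
juxtaposition. -/
theorem mk_eq_extract_mul_extract_compl {p : Pk k} {J : Finset (Fin k)}
    (h : IsUnionOfCycles p J) : mk p = mk (extract p J) * mk (extract p Jᶜ) := by
  rw [← mk_extract_univ p]
  refine mk_extract_eq_mul (J.orderEmbOfFin rfl) (Jᶜ.orderEmbOfFin rfl)
    (J.orderEmbOfFin rfl).injective (Jᶜ.orderEmbOfFin rfl).injective ?_ ?_
    (fun _ _ => Iff.rfl) (fun _ _ => Iff.rfl) ?_
  · intro i j hij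
    have := Finset.orderEmbOfFin_mem Jᶜ rfl j
    rw [← hij, Finset.mem_compl] at this
    exact this (Finset.orderEmbOfFin_mem J rfl i)
  · intro i
    refine iff_of_true (Finset.mem_univ i) ?_
    have h1 := Finset.range_orderEmbOfFin J rfl
    have h2 := Finset.range_orderEmbOfFin Jᶜ rfl
    by_cases hi : i ∈ J
    · exact Or.inl (h1.ge hi)
    · exact Or.inr (h2.ge (by simpa using hi))
  · intro x y hxy
    have hx : Sum.elim id id (Sum.map (J.orderEmbOfFin rfl) (J.orderEmbOfFin rfl) x) ∈ J := by
      rcases x with x | x <;> exact Finset.orderEmbOfFin_mem J rfl x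
    have hy : Sum.elim id id (Sum.map (Jᶜ.orderEmbOfFin rfl) (Jᶜ.orderEmbOfFin rfl) y) ∈ Jᶜ := by
      rcases y with y | y <;> exact Finset.orderEmbOfFin_mem Jᶜ rfl y
    exact Finset.mem_compl.1 hy ((h.mem_iff hxy).1 hx)

/-- Sets of columns of a juxtaposition. -/
def joinColumns (J : Finset (Fin k)) (J' : Finset (Fin l)) : Finset (Fin (k + l)) :=
  (J.disjSum J').map finSumFinEquiv.toEmbedding

theorem castAdd_mem_joinColumns {J : Finset (Fin k)} {J' : Finset (Fin l)} {i : Fin k} :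
    Fin.castAdd l i ∈ joinColumns J J' ↔ i ∈ J := by
  rw [joinColumns, Finset.mem_map_equiv, finSumFinEquiv_symm_apply_castAdd, Finset.inl_mem_disjSum]

theorem natAdd_mem_joinColumns {J : Finset (Fin k)} {J' : Finset (Fin l)} {i : Fin l} :
    Fin.natAdd k i ∈ joinColumns J J' ↔ i ∈ J' := by
  rw [joinColumns, Finset.mem_map_equiv, finSumFinEquiv_symm_apply_natAdd, Finset.inr_mem_disjSum]

theorem joinColumns_compl (J : Finset (Fin k)) (J' : Finset (Fin l)) :
    (joinColumns J J')ᶜ = joinColumns Jᶜ J'ᶜ := by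
  ext i
  rw [Finset.mem_compl]
  refine Fin.addCases (fun i => ?_) (fun i => ?_) i
  · rw [castAdd_mem_joinColumns, castAdd_mem_joinColumns, Finset.mem_compl]
  · rw [natAdd_mem_joinColumns, natAdd_mem_joinColumns, Finset.mem_compl]

theorem isUnionOfCycles_joinColumns {p : Pk k} {q : Pk l} {J : Finset (Fin k)}
    {J' : Finset (Fin l)} : IsUnionOfCycles (tensor p q) (joinColumns J J') ↔
      IsUnionOfCycles p J ∧ IsUnionOfCycles q J' := by
  simp only [isUnionOfCycles_iff, LinRel.mem_fix, mem_toRel_tensor]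
  have h1 : indicator (joinColumns J J') ∘ Fin.castAdd l = indicator J := by
    ext i
    simp only [Function.comp_apply, indicator, castAdd_mem_joinColumns]
  have h2 : indicator (joinColumns J J') ∘ Fin.natAdd k = indicator J' := by
    ext i
    simp only [Function.comp_apply, indicator, natAdd_mem_joinColumns]
  rw [h1, h2]

theorem mk_extract_tensor (p : Pk k) (q : Pk l) (J : Finset (Fin k)) (J' : Finset (Fin l)) :
    mk (extract (tensor p q) (joinColumns J J')) = mk (extract p J) * mk (extract q J') := by
  have hL : ∀ x, Sum.map (Fin.castAdd l ∘ J.orderEmbOfFin rfl)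
      (Fin.castAdd l ∘ J.orderEmbOfFin rfl) x =
      inL k l (Sum.map (J.orderEmbOfFin rfl) (J.orderEmbOfFin rfl) x) := by
    rintro (x | x) <;> rfl
  have hR : ∀ x, Sum.map (Fin.natAdd k ∘ J'.orderEmbOfFin rfl)
      (Fin.natAdd k ∘ J'.orderEmbOfFin rfl) x =
      inR k l (Sum.map (J'.orderEmbOfFin rfl) (J'.orderEmbOfFin rfl) x) := by
    rintro (x | x) <;> rfl
  refine mk_extract_eq_mul (Fin.castAdd l ∘ J.orderEmbOfFin rfl)
    (Fin.natAdd k ∘ J'.orderEmbOfFin rfl)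
    ((Fin.castAdd_injective k l).comp (J.orderEmbOfFin rfl).injective)
    ((Fin.natAdd_injective l k).comp (J'.orderEmbOfFin rfl).injective) ?_ ?_ ?_ ?_ ?_
  · intro i j h
    have h1 := (J.orderEmbOfFin rfl i).isLt
    have h2 := congrArg Fin.val h
    simp only [Function.comp_apply, Fin.val_castAdd, Fin.val_natAdd] at h2
    omega
  · have h1 : ∀ i, (∃ j, J.orderEmbOfFin rfl j = i) ↔ i ∈ J :=
      Set.ext_iff.1 (Finset.range_orderEmbOfFin J rfl)
    have h2 : ∀ i, (∃ j, J'.orderEmbOfFin rfl j = i) ↔ i ∈ J' :=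
      Set.ext_iff.1 (Finset.range_orderEmbOfFin J' rfl)
    have ne : ∀ (i : Fin k) (j : Fin l), Fin.castAdd l i ≠ Fin.natAdd k j := by
      intro i j h
      have := congrArg Fin.val h
      simp only [Fin.val_castAdd, Fin.val_natAdd] at this
      omega
    intro i
    refine Fin.addCases (fun i => ?_) (fun i => ?_) i
    · rw [castAdd_mem_joinColumns]
      simpa [(Fin.castAdd_injective k l).eq_iff, fun i j => (ne i j).symm] using (h1 i).symm
    · rw [natAdd_mem_joinColumns]
      simpa [(Fin.natAdd_injective l k).eq_iff, ne] using (h2 i).symm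
  · intro x y
    rw [hL, hL, tensor_inL_inL, orderEmbOfFin_rel]
  · intro x y
    rw [hR, hR, tensor_inR_inR, orderEmbOfFin_rel]
  · intro x y
    rw [hL, hR]
    exact not_tensor_inL_inR _ _ _ _

open Classical in
-- Pairs of unions of cycles of `p` and of `q` correspond to unions of cycles of `p ⊗ q` through
-- `joinColumns`, which commutes with complements, and the extractions multiply.
theorem deltaPlus_tensor (p : Pk k) (q : Pk l) : deltaPlus (vec (mk (tensor p q))) =
    deltaPlus (vec (mk p)) * deltaPlus (vec (mk q)) := by
  rw [deltaPlus_vec_mk, deltaPlus_vec_mk, deltaPlus_vec_mk, Finset.sum_mul_sum,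
    ← Finset.sum_product']
  symm
  refine Finset.sum_bij (fun x _ => joinColumns x.1 x.2) ?_ ?_ ?_ ?_
  · rintro ⟨J, J'⟩ h
    simp only [Finset.mem_product, Finset.mem_filter, Finset.mem_univ, true_and] at h ⊢
    exact isUnionOfCycles_joinColumns.2 h
  · rintro ⟨J₁, J₂⟩ - ⟨J₃, J₄⟩ - h
    refine Prod.ext (Finset.ext fun i => ?_) (Finset.ext fun i => ?_)
    · rw [← castAdd_mem_joinColumns (J' := J₂), h, castAdd_mem_joinColumns]
    · rw [← natAdd_mem_joinColumns (J := J₁), h, natAdd_mem_joinColumns]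
  · intro J h
    have e : joinColumns (Finset.univ.filter fun i => Fin.castAdd l i ∈ J)
        (Finset.univ.filter fun i => Fin.natAdd k i ∈ J) = J := by
      ext i
      refine Fin.addCases (fun i => ?_) (fun i => ?_) i
      · simp [castAdd_mem_joinColumns]
      · simp [natAdd_mem_joinColumns]
    refine ⟨(_, _), ?_, e⟩
    rw [← e] at h
    simp only [Finset.mem_product, Finset.mem_filter, Finset.mem_univ, true_and] at h ⊢
    exact isUnionOfCycles_joinColumns.1 h
  · rintro ⟨J, J'⟩ -
    rw [joinColumns_compl, mk_extract_tensor, mk_extract_tensor,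
      Algebra.TensorProduct.tmul_mul_tmul, vec_mul_vec, vec_mul_vec]

/-! ### Irreducible partitions -/

/-- Each lower point is joined to the upper point of its column, so only the upper row has to be
connected; `0 < k` excludes the empty diagram, which has no cycle. -/
theorem irreducible_iff {p : Pk k} :
    Irreducible p ↔ 0 < k ∧ ∀ i j, (p ⊔ idPart k) (Sum.inl i) (Sum.inl j) := by
  rw [Irreducible, nc, Nat.card_eq_one_iff_unique]
  constructor
  · rintro ⟨h1, ⟨c⟩⟩
    refine ⟨?_, fun i j => Quotient.exact (Subsingleton.elim _ _)⟩
    induction c using Quotient.inductionOn with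
    | _ c => exact c.elim (fun i => i.pos) fun i => i.pos
  · rintro ⟨hk, h⟩
    refine ⟨⟨fun c d => ?_⟩, ⟨Quotient.mk _ (Sum.inl ⟨0, hk⟩)⟩⟩
    have key : ∀ x, (p ⊔ idPart k) x (Sum.inl ⟨0, hk⟩) := by
      rintro (x | x)
      · exact h _ _
      · exact Setoid.trans' _ (sup_idPart_inr p x) (h _ _)
    induction c using Quotient.inductionOn
    induction d using Quotient.inductionOn
    exact Quotient.sound (Setoid.trans' _ (key _) (Setoid.symm' _ (key _)))

theorem Irreducible.isUnionOfCycles_iff {p : Pk k} (hp : Irreducible p) {J : Finset (Fin k)} :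
    IsUnionOfCycles p J ↔ J = Finset.univ ∨ J = ∅ := by
  constructor
  · intro h
    rcases J.eq_empty_or_nonempty with h' | ⟨i, hi⟩
    · exact Or.inr h'
    · exact Or.inl (Finset.eq_univ_of_forall fun j =>
        (h i j ((irreducible_iff.1 hp).2 i j)).1 hi)
  · rintro (rfl | rfl) <;> intro i j _ <;> simp

/-- With a single cycle the only unions of cycles are the empty set and the set of all columns, and
these differ because `k` is positive. Irreducible orbits are thus primitive. -/
theorem deltaPlus_irreducible {p : Pk k} (hp : Irreducible p) :
    deltaPlus (vec (mk p)) = vec (mk p) ⊗ₜ[ℂ] 1 + 1 ⊗ₜ[ℂ] vec (mk p) := by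
  classical
  have hk := (irreducible_iff.1 hp).1
  have hne : (Finset.univ : Finset (Fin k)) ≠ ∅ := Finset.nonempty_iff_ne_empty.1 ⟨⟨0, hk⟩, by simp⟩
  have h : (Finset.univ.filter fun J : Finset (Fin k) => IsUnionOfCycles p J) =
      {Finset.univ, ∅} := by
    ext J
    simp [hp.isUnionOfCycles_iff]
  rw [deltaPlus_vec_mk, h, Finset.sum_pair hne, Finset.compl_univ, Finset.compl_empty,
    mk_extract_univ, mk_extract_empty]
  rfl

/-- The irreducible orbits generate the monoid of orbits. -/
theorem closure_irreducible :
    Submonoid.closure {x : Orb | ∃ (k : ℕ) (p : Pk k), Irreducible p ∧ x = mk p} = ⊤ := by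
  classical
  refine eq_top_iff.2 fun x _ => ?_
  obtain ⟨k, p, rfl⟩ := mk_surjective x
  induction k using Nat.strong_induction_on with
  | _ k ih =>
  rcases Nat.eq_zero_or_pos k with rfl | hk
  · rw [Subsingleton.elim p (idPart 0)]
    exact Submonoid.one_mem _
  by_cases hp : Irreducible p
  · exact Submonoid.subset_closure ⟨k, p, hp, rfl⟩
  -- The cycle of column 0. It is nonempty, and proper since `p` is not irreducible, so both
  -- extractions have fewer columns and the induction applies to them.
  let J : Finset (Fin k) :=
    Finset.univ.filter fun j => (p ⊔ idPart k) (Sum.inl ⟨0, hk⟩) (Sum.inl j)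
  have hJ : ∀ j, j ∈ J ↔ (p ⊔ idPart k) (Sum.inl ⟨0, hk⟩) (Sum.inl j) := by simp [J]
  have hU : IsUnionOfCycles p J := by
    intro i j hij
    rw [hJ, hJ]
    exact ⟨fun h => Setoid.trans' _ h hij, fun h => Setoid.trans' _ h (Setoid.symm' _ hij)⟩
  have h0 : 0 < J.card := Finset.card_pos.2 ⟨⟨0, hk⟩, (hJ _).2 (Setoid.refl' _ _)⟩
  have h1 : J ≠ Finset.univ := by
    intro h
    refine hp (irreducible_iff.2 ⟨hk, fun i j => ?_⟩)
    have hi := (hJ i).1 (h ▸ Finset.mem_univ i)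
    have hj := (hJ j).1 (h ▸ Finset.mem_univ j)
    exact Setoid.trans' _ (Setoid.symm' _ hi) hj
  have h2 : J.card < k := by simpa using (Finset.card_lt_iff_ne_univ J).2 h1
  rw [mk_eq_extract_mul_extract_compl hU]
  refine Submonoid.mul_mem _ (ih _ h2 _ trivial) (ih _ ?_ _ trivial)
  rw [Finset.card_compl, Fintype.card_fin]
  omega

theorem exists_prod_irreducible (x : Orb) : ∃ (r : ℕ) (k : Fin r → ℕ) (p : ∀ i, Pk (k i)),
    (∀ i, Irreducible (p i)) ∧ x = ∏ i, mk (p i) := by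
  have hx : x ∈ Submonoid.closure {x : Orb | ∃ (k : ℕ) (p : Pk k), Irreducible p ∧ x = mk p} := by
    rw [closure_irreducible]
    trivial
  obtain ⟨L, hL, rfl⟩ := Submonoid.exists_list_of_mem_closure hx
  choose k p hp hmk using fun i : Fin L.length => hL L[i] (List.getElem_mem _)
  refine ⟨L.length, k, p, hp, ?_⟩
  rw [← Fin.prod_univ_getElem]
  exact Finset.prod_congr rfl fun i _ => hmk i

end Cycles

/-! ### The Hopf algebra `(A, Δ_⊞, ε_⊞)` -/

/-- Irreducible orbits generate the monoid of orbits, hence the algebra; this reduces the axioms for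
`Δ_⊞` to primitive elements. -/
theorem algHom_ext_irreducible {B : Type*} [Semiring B] [Algebra ℂ B] {f g : PAlg →ₐ[ℂ] B}
    (h : ∀ (k : ℕ) (p : Pk k), Irreducible p → f (vec (mk p)) = g (vec (mk p))) : f = g := by
  have H : (f : PAlg →* B).comp (MonoidAlgebra.of ℂ Orb) =
      (g : PAlg →* B).comp (MonoidAlgebra.of ℂ Orb) := by
    refine MonoidHom.eq_of_eqOn_denseM closure_irreducible ?_
    rintro _ ⟨k, p, hp, rfl⟩
    exact h k p hp
  refine AlgHom.toLinearMap_injective (linearMap_ext fun k p => ?_)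
  exact DFunLike.congr_fun H (mk p)

theorem deltaPlus_one : deltaPlus 1 = 1 := by
  classical
  have h : (Finset.univ.filter fun J : Finset (Fin 0) => IsUnionOfCycles (idPart 0) J) = {∅} := by
    ext J
    rw [Finset.mem_filter, Finset.mem_singleton]
    exact iff_of_true ⟨Finset.mem_univ _, fun i => i.elim0⟩ (Subsingleton.elim _ _)
  rw [one_eq_vec, deltaPlus_vec_mk, h, Finset.sum_singleton, mk_extract_empty,
    Subsingleton.elim (∅ᶜ : Finset (Fin 0)) ∅, mk_extract_empty]
  rfl

/-- `Δ_⊞` as a homomorphism of algebras. -/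
noncomputable def deltaPlusHom : PAlg →ₐ[ℂ] PAlg ⊗[ℂ] PAlg :=
  AlgHom.ofLinearMap deltaPlus deltaPlus_one
    (linearMap_mul fun _ p _ q => deltaPlus_tensor p q)

theorem deltaPlusHom_irreducible {k : ℕ} {p : Pk k} (hp : Irreducible p) :
    deltaPlusHom (vec (mk p)) = vec (mk p) ⊗ₜ[ℂ] 1 + 1 ⊗ₜ[ℂ] vec (mk p) :=
  deltaPlus_irreducible hp

theorem deltaPlus_prod {r : ℕ} {k : Fin r → ℕ} (p : ∀ i, Pk (k i)) (hp : ∀ i, Irreducible (p i)) :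
    deltaPlus (vec (∏ i, mk (p i))) = ∑ I : Finset (Fin r),
      vec (∏ i ∈ I, mk (p i)) ⊗ₜ[ℂ] vec (∏ i ∈ Iᶜ, mk (p i)) := by
  change deltaPlusHom (MonoidAlgebra.of ℂ Orb _) = _
  rw [map_prod, map_prod]
  have h : ∀ i, deltaPlusHom (MonoidAlgebra.of ℂ Orb (mk (p i))) =
      Algebra.TensorProduct.includeLeft (S := ℂ) (vec (mk (p i))) +
        Algebra.TensorProduct.includeRight (vec (mk (p i))) :=
    fun i => deltaPlusHom_irreducible (hp i)
  -- In the expansion of the product of the sums `x ⊗ 1 + 1 ⊗ x`, the set `I` records the factors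
  -- from which `x ⊗ 1` is taken.
  rw [Finset.prod_congr rfl fun i _ => h i, Finset.prod_add, Finset.powerset_univ]
  refine Finset.sum_congr rfl fun I _ => ?_
  rw [← map_prod, ← map_prod, ← map_prod, ← map_prod, ← Finset.compl_eq_univ_sdiff,
    Algebra.TensorProduct.includeLeft_apply, Algebra.TensorProduct.includeRight_apply,
    Algebra.TensorProduct.tmul_mul_tmul, one_mul, mul_one]

/-! ### The counit and the antipode for `Δ_⊞`. -/

theorem mk_eq_one_iff {k : ℕ} {p : Pk k} : mk p = mk (idPart 0) ↔ k = 0 := by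
  constructor
  · exact congrArg dg
  · rintro rfl
    rw [Subsingleton.elim p]

open Classical in
theorem counitPlus_vec {k : ℕ} (p : Pk k) :
    counitPlus (vec (mk p)) = if k = 0 then 1 else 0 := by
  rw [counitPlus, linExt_vec]
  exact if_congr mk_eq_one_iff rfl rfl

/-- `ε_⊞` as a homomorphism of algebras. -/
noncomputable def counitPlusHom : PAlg →ₐ[ℂ] ℂ :=
  AlgHom.ofLinearMap counitPlus (by rw [one_eq_vec, counitPlus_vec, if_pos rfl])
    (linearMap_mul fun k p l q => by
      simp only [counitPlus_vec, Nat.add_eq_zero_iff, ite_and]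
      split_ifs <;> simp)

theorem counitPlusHom_irreducible {k : ℕ} {p : Pk k} (hp : Irreducible p) :
    counitPlusHom (vec (mk p)) = 0 :=
  (counitPlus_vec p).trans (if_neg (irreducible_iff.1 hp).1.ne')

/-- The number of cycles. -/
noncomputable def cycleCount : Orb → ℕ :=
  Orb.lift (fun k p => nc (p ⊔ idPart k)) fun k e p => by
    -- Relabelling fixes `id_k` and so commutes with the join; the reverse inclusion is the first
    -- one applied to `e.symm`.
    have h : relabel e p ⊔ idPart k = relabel e (p ⊔ idPart k) := by
      have key : ∀ (e : Equiv.Perm (Fin k)) (p : Pk k),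
          relabel e p ⊔ idPart k ≤ relabel e (p ⊔ idPart k) := by
        intro e p
        refine sup_le (fun _ _ h => (le_sup_left : p ≤ p ⊔ idPart k) h) ?_
        conv_lhs => rw [← idPart_relabel e]
        exact fun _ _ h => (le_sup_right : idPart k ≤ p ⊔ idPart k) h
      refine le_antisymm (key e p) fun x y hxy => ?_
      have h := key e.symm (relabel e p)
      rw [← relabel_trans, Equiv.self_trans_symm, relabel_refl] at h
      have := h hxy
      rw [relabel_rel] at this
      rcases x with x | x <;> rcases y with y | y <;> simpa using this
    rw [h]
    exact nc_comap _ _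

/-- The antipode of `(A, Δ_⊞, ε_⊞)`. -/
noncomputable def antipodePlus : PAlg →ₗ[ℂ] PAlg :=
  linExt fun x => (-1 : ℂ) ^ cycleCount x • vec x

theorem antipodePlus_vec {k : ℕ} (p : Pk k) :
    antipodePlus (vec (mk p)) = (-1 : ℂ) ^ nc (p ⊔ idPart k) • vec (mk p) :=
  linExt_vec _ _

theorem antipodePlus_one : antipodePlus 1 = 1 := by
  rw [one_eq_vec, antipodePlus_vec, sup_idem, nc_idPart, pow_zero, one_smul]

/-- The antipode as a homomorphism of algebras. -/
noncomputable def antipodePlusHom : PAlg →ₐ[ℂ] PAlg :=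
  AlgHom.ofLinearMap antipodePlus antipodePlus_one (linearMap_mul fun k p l q => by
    rw [antipodePlus_vec, antipodePlus_vec, antipodePlus_vec, nc_tensor_sup_idPart,
      smul_mul_smul_comm, vec_mul_vec, mk_mul_mk, pow_add])

/-- An antipode has to negate primitive elements. As the number of cycles is additive under
juxtaposition, the sign counting cycles is the multiplicative extension of this rule. -/
theorem antipodePlusHom_irreducible {k : ℕ} {p : Pk k} (hp : Irreducible p) :
    antipodePlusHom (vec (mk p)) = - vec (mk p) := by
  refine (antipodePlus_vec p).trans ?_
  rw [show nc (p ⊔ idPart k) = 1 from hp, pow_one, neg_one_smul]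

/-- Every coalgebra axiom is an equality of algebra homomorphisms, and on a primitive element both
sides are computed directly. -/
theorem isBialgebra_deltaPlus : IsBialgebra deltaPlus counitPlus where
  coassoc := by
    have H : ((Algebra.TensorProduct.assoc ℂ ℂ ℂ PAlg PAlg PAlg).toAlgHom.comp
        (Algebra.TensorProduct.map deltaPlusHom (AlgHom.id ℂ PAlg))).comp deltaPlusHom =
        (Algebra.TensorProduct.map (AlgHom.id ℂ PAlg) deltaPlusHom).comp deltaPlusHom := by
      refine algHom_ext_irreducible fun k p hp => ?_
      simp [deltaPlusHom_irreducible hp, TensorProduct.add_tmul, TensorProduct.tmul_add,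
        Algebra.TensorProduct.one_def, add_assoc, -MonoidAlgebra.of_apply]
    exact congrArg AlgHom.toLinearMap H
  counit_left := by
    have H : (Algebra.TensorProduct.map counitPlusHom (AlgHom.id ℂ PAlg)).comp deltaPlusHom =
        Algebra.TensorProduct.includeRight := by
      refine algHom_ext_irreducible fun k p hp => ?_
      simp [deltaPlusHom_irreducible hp, counitPlusHom_irreducible hp, -MonoidAlgebra.of_apply]
    exact congrArg AlgHom.toLinearMap H
  counit_right := by
    have H : (Algebra.TensorProduct.map (AlgHom.id ℂ PAlg) counitPlusHom).comp deltaPlusHom =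
        Algebra.TensorProduct.includeLeft := by
      refine algHom_ext_irreducible fun k p hp => ?_
      simp [deltaPlusHom_irreducible hp, counitPlusHom_irreducible hp, -MonoidAlgebra.of_apply]
    exact congrArg AlgHom.toLinearMap H
  counit_one := map_one counitPlusHom
  counit_mul := map_mul counitPlusHom
  comul_one := map_one deltaPlusHom
  comul_mul := map_mul deltaPlusHom

/-! ### The grading by the number of columns, and the Hopf algebra given by `Δ_⊞`. -/

theorem vec_mk_mem_component {k n : ℕ} (p : Pk k) (h : k = n) : vec (mk p) ∈ component n := by
  subst h
  exact Submodule.subset_span ⟨p, rfl⟩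

theorem component_le_iff {n : ℕ} {S : Submodule ℂ PAlg} :
    component n ≤ S ↔ ∀ p : Pk n, vec (mk p) ∈ S := by
  rw [component, Submodule.span_le]
  exact ⟨fun h p => h ⟨p, rfl⟩, by rintro h _ ⟨p, rfl⟩; exact h p⟩

/-- The orbits of degree `n` and those of other degrees are disjoint parts of one basis, so their
spans are independent. -/
theorem isInternal_component : DirectSum.IsInternal component := by
  rw [DirectSum.isInternal_submodule_iff_iSupIndep_and_iSup_eq_top]
  constructor
  · intro n
    have hb := (MonoidAlgebra.basis Orb ℂ).linearIndependent
    have hd : Disjoint {x : Orb | dg x = n} {x | dg x ≠ n} :=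
      Set.disjoint_left.2 fun x h h' => h' h
    have h := hb.disjoint_span_image hd
    have hv : ∀ x : Orb, vec x = MonoidAlgebra.basis Orb ℂ x :=
      fun x => (MonoidAlgebra.basis_apply ..).symm
    refine h.mono (component_le_iff.2 fun p => ?_)
      (iSup₂_le fun m hm => component_le_iff.2 fun p => ?_)
    · exact Submodule.subset_span ⟨mk p, rfl, (hv _).symm⟩
    · exact Submodule.subset_span ⟨mk p, hm, (hv _).symm⟩
  · rw [eq_top_iff, ← (MonoidAlgebra.basis Orb ℂ).span_eq, Submodule.span_le]
    rintro _ ⟨x, rfl⟩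
    obtain ⟨k, p, rfl⟩ := mk_surjective x
    rw [MonoidAlgebra.basis_apply]
    exact Submodule.mem_iSup_of_mem k (vec_mk_mem_component p rfl)

theorem gradedMonoid_component : SetLike.GradedMonoid component where
  one_mem := vec_mk_mem_component (idPart 0) rfl
  mul_mem := by
    intro i j a b ha hb
    have h : component i ≤ Submodule.comap (LinearMap.mulRight ℂ b) (component (i + j)) := by
      refine component_le_iff.2 fun p => ?_
      have h' : component j ≤
          Submodule.comap (LinearMap.mulLeft ℂ (vec (mk p))) (component (i + j)) := by
        refine component_le_iff.2 fun q => ?_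
        change vec (mk p) * vec (mk q) ∈ component (i + j)
        rw [vec_mul_vec, mk_mul_mk]
        exact vec_mk_mem_component _ rfl
      exact h' hb
    exact h ha

theorem isGradedConnectedHopfAlgebra_deltaPlus :
    IsGradedConnectedHopfAlgebra component deltaPlus counitPlus where
  toIsBialgebra := isBialgebra_deltaPlus
  isInternal := isInternal_component
  gradedMonoid := gradedMonoid_component
  comul_mem := by
    classical
    intro n a ha
    refine Submodule.mem_comap.1 (component_le_iff.2 (fun p => ?_) ha)
    rw [Submodule.mem_comap, deltaPlus_vec_mk]
    refine Submodule.sum_mem _ fun J _ => ?_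
    have hc : (J.card, Jᶜ.card) ∈ Finset.HasAntidiagonal.antidiagonal n := by
      rw [Finset.HasAntidiagonal.mem_antidiagonal, Finset.card_add_card_compl, Fintype.card_fin]
    refine Submodule.mem_iSup_of_mem (J.card, Jᶜ.card) (Submodule.mem_iSup_of_mem hc ?_)
    exact ⟨⟨_, vec_mk_mem_component (extract p J) rfl⟩ ⊗ₜ
      ⟨_, vec_mk_mem_component (extract p Jᶜ) rfl⟩, rfl⟩
  counit_eq_zero := by
    intro n hn a ha
    refine (component_le_iff (S := LinearMap.ker counitPlus)).2 (fun p => ?_) ha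
    rw [LinearMap.mem_ker, counitPlus_vec, if_neg hn]
  connected := by
    refine congrArg (Submodule.span ℂ) (Set.ext fun v => ?_)
    rw [Set.mem_singleton_iff, one_eq_vec]
    constructor
    · rintro ⟨p, rfl⟩
      rw [Subsingleton.elim p]
    · rintro rfl
      exact ⟨_, rfl⟩
  exists_antipode := by
    refine ⟨antipodePlus, ?_, ?_, ?_⟩
    -- The algebra is commutative, so multiplication is itself an algebra homomorphism and
    -- irreducible orbits suffice; on them the identity reads `-[p] + [p] = 0 = ε_⊞([p])`.
    · have H : ((Algebra.TensorProduct.lmul' ℂ (S := PAlg)).comp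
          (Algebra.TensorProduct.map antipodePlusHom (AlgHom.id ℂ PAlg))).comp deltaPlusHom =
          (Algebra.ofId ℂ PAlg).comp counitPlusHom := by
        refine algHom_ext_irreducible fun k p hp => ?_
        simp [deltaPlusHom_irreducible hp, counitPlusHom_irreducible hp,
          antipodePlusHom_irreducible hp, -MonoidAlgebra.of_apply]
      exact congrArg AlgHom.toLinearMap H
    · have H : ((Algebra.TensorProduct.lmul' ℂ (S := PAlg)).comp
          (Algebra.TensorProduct.map (AlgHom.id ℂ PAlg) antipodePlusHom)).comp deltaPlusHom =
          (Algebra.ofId ℂ PAlg).comp counitPlusHom := by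
        refine algHom_ext_irreducible fun k p hp => ?_
        simp [deltaPlusHom_irreducible hp, counitPlusHom_irreducible hp,
          antipodePlusHom_irreducible hp, -MonoidAlgebra.of_apply]
      exact congrArg AlgHom.toLinearMap H
    · intro n a ha
      refine Submodule.mem_comap.1 (component_le_iff.2 (fun p => ?_) ha)
      rw [Submodule.mem_comap, antipodePlus_vec]
      exact Submodule.smul_mem _ _ (vec_mk_mem_component p rfl)

end SetPartition

theorem mainTheorem8 :
    -- the defining formula of `Δ_⊞`: every orbit is a product of irreducible ones, and `Δ_⊞` of
    -- such a product is the sum over the splittings of the family of factors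
    (∀ x : SetPartition.Orb, ∃ (r : ℕ) (k : Fin r → ℕ) (p : ∀ i, SetPartition.Pk (k i)),
      (∀ i, SetPartition.Irreducible (p i)) ∧ x = ∏ i, SetPartition.mk (p i)) ∧
    (∀ (r : ℕ) (k : Fin r → ℕ) (p : ∀ i, SetPartition.Pk (k i)),
      (∀ i, SetPartition.Irreducible (p i)) →
      SetPartition.deltaPlus (SetPartition.vec (∏ i, SetPartition.mk (p i))) =
        ∑ I : Finset (Fin r), SetPartition.vec (∏ i ∈ I, SetPartition.mk (p i)) ⊗ₜ[ℂ]
          SetPartition.vec (∏ i ∈ Iᶜ, SetPartition.mk (p i))) ∧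
    -- the structure given by `Δ_⊞`
    SetPartition.IsGradedConnectedHopfAlgebra SetPartition.component
      SetPartition.deltaPlus SetPartition.counitPlus ∧
    -- the structure given by `Δ_⊠`
    SetPartition.IsBialgebra SetPartition.deltaTimes SetPartition.counitTimes := by
  exact ⟨SetPartition.exists_prod_irreducible, fun _ _ p hp => SetPartition.deltaPlus_prod p hp,
    SetPartition.isGradedConnectedHopfAlgebra_deltaPlus, SetPartition.isBialgebra_deltaTimes⟩
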